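/- Let $n,j,k\in\mathbb N$ with $1\le j<k$, let $P,Q,R\in(1,\infty]$ and $p,q,r\in[1,\infty]$ satisfy $$\frac1P=\frac{j/k}{R}+\frac{1-j/k}{Q},\qquad \frac1p=\frac{j/k}{r}+\frac{1-j/k}{q}\qquad(1/\infty:=0).$$ Then there is a constant $C<\infty$, depending only on $n,j,k,P,Q,R,p,q,r$, such that $$\|\nabla^j u\|_{P,p}\le C\,\|\nabla^k u\|_{R,r}^{j/k}\,\|u\|_{Q,q}^{1-j/k}$$ for every $k$-times weakly differentiable $u:\mathbb R^n\to\mathbb R$ for which the right-hand side is not of the indeterminate form $0\cdot\infty$ (that is, except when $\nabla^k u=0$ a.e. and $\|u\|_{Q,q}=\infty$). Here $u$ is $k$-times weakly differentiable if $u\in L^1_{\mathrm{loc}}(\mathbb R^n)$ and all its weak partial derivatives of order at most $k$ exist in $L^1_{\mathrm{loc}}(\mathbb R^n)$; $\nabla^m u$ is the tensor of all weak partial derivatives $\partial_{a_1}\cdots\partial_{a_m}u$, $1\le a_1,\dots,a_m\le n$, and $|\nabla^m u|$ is its Euclidean norm. For a measurable scalar- or vector-valued function $f$ on $\mathbb R^n$,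 $f^*(t)=\inf\{s>0:|\{|f|>s\}|\le t\}$ for $t>0$ (with $\inf\emptyset=\infty$, and $|\{|f|>s\}|$ the Lebesgue measure), and for $1\le A,a\le\infty$ $$\|f\|_{A,a}=\bigl\|t^{1/A-1/a}f^*(t)\bigr\|_{L^a(0,\infty)}\in[0,\infty].$$ -/

import Mathlib

open MeasureTheory
open scoped ENNReal NNReal ContDiff

namespace GagliardoNirenberg

/-- `ℝⁿ` with the Euclidean norm and Lebesgue measure. -/
abbrev Eucl (n : ℕ) : Type := EuclideanSpace ℝ (Fin n)

/-- Values of the `m`-th gradient: all partial derivatives `∂_{a 0} ⋯ ∂_{a (m-1)} u`,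
with the Euclidean norm. -/
abbrev Tensor (n m : ℕ) : Type := EuclideanSpace ℝ (Fin m → Fin n)

/-- The classical iterated partial derivative `∂_{a 0} ⋯ ∂_{a (m-1)} φ`. -/
noncomputable def partialDeriv {n m : ℕ} (a : Fin m → Fin n) (φ : Eucl n → ℝ) (x : Eucl n) : ℝ :=
  iteratedFDeriv ℝ m φ x (fun i => EuclideanSpace.single (a i) (1 : ℝ))

/-- `G` is (a representative of) the `m`-th weak gradient `∇ᵐ u` on `ℝⁿ`. -/
structure IsWeakGradient {n : ℕ} (m : ℕ) (u : Eucl n → ℝ) (G : Eucl n → Tensor n m) : Prop where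
  locallyIntegrable : LocallyIntegrable G volume
  integral_eq : ∀ φ : Eucl n → ℝ, ContDiff ℝ ∞ φ → HasCompactSupport φ →
    ∀ a : Fin m → Fin n,
      ∫ x, u x * partialDeriv a φ x = (-1 : ℝ) ^ m * ∫ x, G x a * φ x

/-- `u` is `k`-times weakly differentiable: `u` is locally integrable and has locally integrable
weak derivatives of all orders up to `k`. -/
structure WeaklyDifferentiable {n : ℕ} (k : ℕ) (u : Eucl n → ℝ) : Prop where
  locallyIntegrable : LocallyIntegrable u volume
  exists_gradient : ∀ m ≤ k, ∃ G : Eucl n → Tensor n m, IsWeakGradient m u G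

/-- The non-increasing rearrangement `f*(t) = inf {s : |{|f| > s}| ≤ t}`. The levels `s = 0` and
`s = ∞` are admitted; this does not change the infimum. -/
noncomputable def rearrangement {n : ℕ} {F : Type*} [NormedAddCommGroup F] (f : Eucl n → F)
    (t : ℝ) : ℝ≥0∞ :=
  sInf {s : ℝ≥0∞ | volume {x | s < ‖f x‖ₑ} ≤ ENNReal.ofReal t}

/-- The Lorentz functional `‖f‖_{P,p} = ‖t ^ (1/P - 1/p) f*(t)‖_{Lᵖ(0,∞)}`, with `1/∞ = 0`. -/
noncomputable def lorentzNorm {n : ℕ} {F : Type*} [NormedAddCommGroup F] (f : Eucl n → F)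
    (P p : ℝ≥0∞) : ℝ≥0∞ :=
  eLpNorm (fun t : ℝ => ENNReal.ofReal (t ^ ((1 / P).toReal - (1 / p).toReal)) * rearrangement f t)
    p (volume.restrict (Set.Ioi 0))

end GagliardoNirenberg

open GagliardoNirenberg

/-!
Averaging `∂_a w` of a smooth `w` against a bump function at scale `s` around `x` gives a smooth
function `f s` with `f 0 = ∂_a w x`. For `s > 0`, integrating by parts bounds `|f s|` by
`C * s ^ (-j) * M w x`, where `M` is the maximal function and `j` the order of `∂_a`, while the
`l`-th derivative of `f` is bounded by `C * M |∇^(j+l) w| x`. Expressing `f 0` through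
`f ε, …, f (l ε)` and the `l`-th finite difference of `f` gives, for every `ε > 0`,
`|∇^j w| ≤ C * (ε ^ (-j) * M w + ε ^ l * M |∇^(j+l) w|)`.
Mollification carries this over to weak gradients, with `M` replaced by `M ∘ M`, and the best `ε`
turns the right-hand side into `C * (M M |∇^k u|) ^ (j/k) * (M M u) ^ (1 - j/k)`, where `k = j + l`.
Now apply Hölder's inequality for rearrangements and the boundedness of `M` for the Lorentz
functionals with first exponent `> 1`. The latter follows from the weak-type `(1, 1)` inequality,
which bounds `(M g)* t` by a dyadic sum of values of `g*`, and Hardy's inequality.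
-/

namespace GagliardoNirenberg

open Set Filter Topology Metric

section LebesgueNorms

variable {α : Type*} [MeasurableSpace α] {μ : Measure α}

lemma eLpNorm_const_mul_ennreal (c : ℝ≥0∞) {f : α → ℝ≥0∞} (hf : AEMeasurable f μ) (p : ℝ≥0∞) :
    eLpNorm (fun x => c * f x) p μ = c * eLpNorm f p μ := by
  rcases eq_or_ne p 0 with rfl | hp0
  · simp
  rcases eq_or_ne p ⊤ with rfl | hp
  · exact ENNReal.essSup_const_mul
  · have hp' := ENNReal.toReal_pos hp0 hp
    simp only [eLpNorm_eq_lintegral_rpow_enorm_toReal hp0 hp, enorm_eq_self,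
      ENNReal.mul_rpow_of_nonneg _ _ hp'.le]
    rw [lintegral_const_mul'' _ (hf.pow_const _), ENNReal.mul_rpow_of_nonneg _ _ (by positivity),
      one_div, ENNReal.rpow_rpow_inv hp'.ne']

lemma eLpNorm_tsum_le {f : ℕ → α → ℝ≥0∞} (hf : ∀ i, AEMeasurable (f i) μ) {p : ℝ≥0∞}
    (hp : 1 ≤ p) :
    eLpNorm (fun x => ∑' i, f i x) p μ ≤ ∑' i, eLpNorm (f i) p μ := by
  rcases eq_or_ne p ⊤ with rfl | hpt
  · refine essSup_le_of_ae_le _ ?_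
    filter_upwards [ae_all_iff.2 fun i => ENNReal.ae_le_essSup (μ := μ) (f i)] with x hx
    exact ENNReal.tsum_le_tsum hx
  have hp0 : p ≠ 0 := (zero_lt_one.trans_le hp).ne'
  have hp' := ENNReal.toReal_pos hp0 hpt
  have partial_sum_le (N : ℕ) : eLpNorm (fun x => ∑ i ∈ Finset.range N, f i x) p μ
      ≤ ∑' i, eLpNorm (f i) p μ := by
    have := eLpNorm_sum_le (s := Finset.range N) (fun i _ => (hf i).aestronglyMeasurable) hp
    rw [Finset.sum_fn] at this
    exact this.trans (ENNReal.sum_le_tsum _)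
  have rpow_tsum (x : α) : (∑' i, f i x) ^ p.toReal
      = ⨆ N, (∑ i ∈ Finset.range N, f i x) ^ p.toReal := by
    rw [ENNReal.tsum_eq_iSup_nat]
    exact (ENNReal.orderIsoRpow _ hp').map_iSup _
  simp only [eLpNorm_eq_lintegral_rpow_enorm_toReal hp0 hpt, enorm_eq_self, one_div,
    ENNReal.rpow_inv_le_iff hp'] at partial_sum_le ⊢
  simp_rw [rpow_tsum]
  rw [lintegral_iSup' fun N => (Finset.aemeasurable_fun_sum _ fun i _ => hf i).pow_const _]
  · exact iSup_le partial_sum_le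
  · refine ae_of_all _ fun x a b hab => ENNReal.rpow_le_rpow ?_ hp'.le
    exact Finset.sum_le_sum_of_subset (Finset.range_mono hab)

lemma eLpNorm_mul_le_eLpNorm_top_mul (f : α → ℝ≥0∞) {g : α → ℝ≥0∞} (hg : AEMeasurable g μ)
    (p : ℝ≥0∞) :
    eLpNorm (fun x => f x * g x) p μ ≤ eLpNorm f ⊤ μ * eLpNorm g p μ := by
  rw [← eLpNorm_const_mul_ennreal _ hg]
  refine eLpNorm_mono_enorm_ae ?_
  filter_upwards [ENNReal.ae_le_essSup f] with x hx
  exact mul_le_mul_left hx (g x)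

lemma eLpNorm_mul_le_mul_eLpNorm {f g : α → ℝ≥0∞} (hf : AEMeasurable f μ) (hg : AEMeasurable g μ)
    {p q r : ℝ≥0∞} [hpqr : p.HolderTriple q r] :
    eLpNorm (fun x => f x * g x) r μ ≤ eLpNorm f p μ * eLpNorm g q μ := by
  have inv_add_inv := hpqr.inv_add_inv_eq_inv
  rcases eq_or_ne p ⊤ with rfl | hp
  · obtain rfl : q = r := by simpa using inv_add_inv
    exact eLpNorm_mul_le_eLpNorm_top_mul f hg q
  rcases eq_or_ne q ⊤ with rfl | hq
  · obtain rfl : p = r := by simpa using inv_add_inv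
    simpa only [mul_comm] using eLpNorm_mul_le_eLpNorm_top_mul g hf p
  rcases eq_or_ne r 0 with rfl | hr0
  · simp
  have hp0 : p ≠ 0 := by
    rintro rfl
    simp [eq_comm, hr0] at inv_add_inv
  have hq0 : q ≠ 0 := by
    rintro rfl
    simp [eq_comm, hr0] at inv_add_inv
  have hr : r ≠ ⊤ := by
    rintro rfl
    simp [hp] at inv_add_inv
  have triple := (ENNReal.HolderTriple.toReal_iff r (ENNReal.toReal_pos hp0 hp)
    (ENNReal.toReal_pos hq0 hq)).2 hpqr
  rw [eLpNorm_eq_lintegral_rpow_enorm_toReal hp0 hp,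
    eLpNorm_eq_lintegral_rpow_enorm_toReal hq0 hq, eLpNorm_eq_lintegral_rpow_enorm_toReal hr0 hr]
  exact ENNReal.lintegral_Lp_mul_le_Lq_mul_Lr triple.pos' triple.lt triple.one_div_eq μ hf hg

lemma eLpNorm_rpow_mul_rpow_le {F G : α → ℝ≥0∞} (hF : AEMeasurable F μ) (hG : AEMeasurable G μ)
    {θ η : ℝ} (hθ : 0 < θ) (hη : 0 < η) {p q r : ℝ≥0∞}
    (hpqr : 1 / p = ENNReal.ofReal θ / r + ENNReal.ofReal η / q) :
    eLpNorm (fun x => F x ^ θ * G x ^ η) p μ ≤ eLpNorm F r μ ^ θ * eLpNorm G q μ ^ η := by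
  have eLpNorm_rpow (H : α → ℝ≥0∞) {s : ℝ≥0∞} {ϑ : ℝ} (hϑ : 0 < ϑ) :
      eLpNorm (fun x => H x ^ ϑ) (s / ENNReal.ofReal ϑ) μ = eLpNorm H s μ ^ ϑ := by
    have := eLpNorm_enorm_rpow (p := s / ENNReal.ofReal ϑ) (μ := μ) H hϑ
    rwa [ENNReal.div_mul_cancel (ENNReal.ofReal_pos.2 hϑ).ne' ENNReal.ofReal_ne_top] at this
  have : (r / ENNReal.ofReal θ).HolderTriple (q / ENNReal.ofReal η) p := ⟨by
    rw [ENNReal.inv_div (.inl ENNReal.ofReal_ne_top) (.inl (ENNReal.ofReal_pos.2 hθ).ne'),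
      ENNReal.inv_div (.inl ENNReal.ofReal_ne_top) (.inl (ENNReal.ofReal_pos.2 hη).ne'),
      ← one_div, hpqr]⟩
  rw [← eLpNorm_rpow F hθ, ← eLpNorm_rpow G hη]
  exact eLpNorm_mul_le_mul_eLpNorm (hF.pow_const θ) (hG.pow_const η)

end LebesgueNorms

section Rearrangement

variable {α β : Type*} [MeasurableSpace α] [MeasurableSpace β] {μ : Measure α} {ν : Measure β}
  {g h : α → ℝ≥0∞} {P p : ℝ≥0∞}

/-- The non-increasing rearrangement `g*(t)` of a `[0, ∞]`-valued function on an arbitrary measure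
space; `rearrangement f` is the rearrangement of `‖f ·‖ₑ` for Lebesgue measure. -/
noncomputable def measureRearrangement (μ : Measure α) (g : α → ℝ≥0∞) (t : ℝ) : ℝ≥0∞ :=
  sInf {s : ℝ≥0∞ | μ {x | s < g x} ≤ ENNReal.ofReal t}

/-- The Lorentz functional of a `[0, ∞]`-valued function on an arbitrary measure space. -/
noncomputable def lorentzFunctional (μ : Measure α) (g : α → ℝ≥0∞) (P p : ℝ≥0∞) : ℝ≥0∞ :=
  eLpNorm (fun t : ℝ =>
      ENNReal.ofReal (t ^ ((1 / P).toReal - (1 / p).toReal)) * measureRearrangement μ g t)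
    p (volume.restrict (Ioi 0))

lemma lorentzNorm_eq_lorentzFunctional {n : ℕ} {F : Type*} [NormedAddCommGroup F]
    (f : Eucl n → F) (P p : ℝ≥0∞) :
    lorentzNorm f P p = lorentzFunctional volume (‖f ·‖ₑ) P p := rfl

lemma measure_measureRearrangement_lt_le (μ : Measure α) (g : α → ℝ≥0∞) (t : ℝ) :
    μ {x | measureRearrangement μ g t < g x} ≤ ENNReal.ofReal t := by
  obtain ⟨s, hs, hlim, hmem⟩ := exists_seq_tendsto_sInf
    (S := {s : ℝ≥0∞ | μ {x | s < g x} ≤ ENNReal.ofReal t}) ⟨⊤, by simp⟩ (OrderBot.bddBelow _)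
  have subset_iUnion : {x | measureRearrangement μ g t < g x} ⊆ ⋃ i, {x | s i < g x} :=
    fun x hx => mem_iUnion.2 (hlim.eventually_lt_const hx).exists
  have monotone_lt : Monotone fun i => {x | s i < g x} :=
    fun a b hab x hx => lt_of_le_of_lt (hs hab) hx
  refine (measure_mono subset_iUnion).trans ?_
  rw [monotone_lt.measure_iUnion]
  exact iSup_le hmem

lemma measureRearrangement_le_iff {t : ℝ} {s : ℝ≥0∞} :
    measureRearrangement μ g t ≤ s ↔ μ {x | s < g x} ≤ ENNReal.ofReal t :=
  ⟨fun h => (measure_mono fun _ hx => h.trans_lt hx).trans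
    (measure_measureRearrangement_lt_le μ g t), fun h => sInf_le h⟩

lemma measureRearrangement_antitone (μ : Measure α) (g : α → ℝ≥0∞) :
    Antitone (measureRearrangement μ g) := fun _ _ hab =>
  measureRearrangement_le_iff.2
    ((measure_measureRearrangement_lt_le μ g _).trans (ENNReal.ofReal_le_ofReal hab))

lemma measureRearrangement_mono_ae (hgh : g ≤ᵐ[μ] h) (t : ℝ) :
    measureRearrangement μ g t ≤ measureRearrangement μ h t := by
  refine measureRearrangement_le_iff.2
    ((measure_mono_ae ?_).trans (measure_measureRearrangement_lt_le μ h t))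
  filter_upwards [hgh] with x hx hlt
  exact lt_of_lt_of_le hlt hx

lemma measureRearrangement_const_add_le (c : ℝ≥0∞) (g : α → ℝ≥0∞) (t : ℝ) :
    measureRearrangement μ (fun x => c + g x) t ≤ c + measureRearrangement μ g t :=
  sInf_le <| (measure_mono fun _ (hx : c + _ < c + _) => lt_of_add_lt_add_left hx).trans
    (measure_measureRearrangement_lt_le μ g t)

lemma measureRearrangement_le_of_weak_type {K : ℝ≥0∞} (hK : ∀ s, s * μ {x | s < g x} ≤ K) {t : ℝ}
    (ht : 0 < t) : measureRearrangement μ g t ≤ K / ENNReal.ofReal t := by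
  refine le_of_forall_lt_imp_le_of_dense fun s hs => ?_
  rw [ENNReal.le_div_iff_mul_le (.inl (ENNReal.ofReal_pos.2 ht).ne') (.inl ENNReal.ofReal_ne_top)]
  have ofReal_lt := not_le.1 (measureRearrangement_le_iff.not.1 hs.not_ge)
  exact (mul_le_mul_right ofReal_lt.le s).trans (hK s)

lemma measureRearrangement_mul_rpow_le (A B : α → ℝ≥0∞) (c : ℝ≥0∞) {a b : ℝ} (ha : 0 ≤ a)
    (hb : 0 ≤ b) (t : ℝ) :
    measureRearrangement μ (fun x => c * (A x ^ a * B x ^ b)) t ≤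
      c * (measureRearrangement μ A (2⁻¹ * t) ^ a * measureRearrangement μ B (2⁻¹ * t) ^ b) := by
  refine measureRearrangement_le_iff.2 ?_
  calc
    _ ≤ μ ({x | measureRearrangement μ A (2⁻¹ * t) < A x} ∪
          {x | measureRearrangement μ B (2⁻¹ * t) < B x}) := by
      refine measure_mono fun x hx => ?_
      contrapose! hx
      simp only [mem_union, mem_ofPred_eq, not_or, not_lt] at hx ⊢
      gcongr
      exacts [hx.1, hx.2]
    _ ≤ ENNReal.ofReal (2⁻¹ * t) + ENNReal.ofReal (2⁻¹ * t) :=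
      (measure_union_le _ _).trans (add_le_add (measure_measureRearrangement_lt_le _ _ _)
        (measure_measureRearrangement_lt_le _ _ _))
    _ = ENNReal.ofReal t := by
      rw [← two_mul, ← ENNReal.ofReal_ofNat, ← ENNReal.ofReal_mul zero_le_two,
        mul_inv_cancel_left₀ two_ne_zero]

lemma measurable_weight_mul_measureRearrangement (μ : Measure α) (g : α → ℝ≥0∞) (a : ℝ) :
    Measurable fun t : ℝ => ENNReal.ofReal (t ^ a) * measureRearrangement μ g t :=
  (by fun_prop : Measurable fun t : ℝ => ENNReal.ofReal (t ^ a)).mul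
    (measureRearrangement_antitone μ g).measurable

lemma measure_eq_zero_of_ae_measureRearrangement_lt {S : Set α}
    (hS : ∀ᵐ t ∂volume.restrict (Ioi 0), ∀ x ∈ S, measureRearrangement μ g t < g x) : μ S = 0 := by
  rw [ae_restrict_iff' measurableSet_Ioi] at hS
  refine nonpos_iff_eq_zero.1 (ENNReal.le_of_forall_pos_le_add fun ε hε _ => ?_)
  obtain ⟨t, ht, hlt⟩ := (Measure.dense_of_ae hS).exists_mem_open isOpen_Ioo
    (nonempty_Ioo.2 (NNReal.coe_pos.2 hε))
  calc μ S ≤ μ {x | measureRearrangement μ g t < g x} := measure_mono (ht hlt.1)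
    _ ≤ ENNReal.ofReal t := measure_measureRearrangement_lt_le μ g t
    _ ≤ 0 + ε := by simpa using ENNReal.ofReal_le_ofReal hlt.2.le

lemma ae_lt_top_of_eLpNorm_ne_top {f : α → ℝ≥0∞} (hf : AEMeasurable f μ) (hp : p ≠ 0)
    (hfp : eLpNorm f p μ ≠ ⊤) : ∀ᵐ x ∂μ, f x < ⊤ := by
  rcases eq_or_ne p ⊤ with rfl | hpt
  · filter_upwards [ENNReal.ae_le_essSup f] with x hx
    exact hx.trans_lt (Ne.lt_top hfp)
  · have hp' := ENNReal.toReal_pos hp hpt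
    filter_upwards [ae_lt_top' (hf.pow_const p.toReal)
      (lintegral_rpow_enorm_lt_top_of_eLpNorm_lt_top hp hpt hfp.lt_top).ne] with x hx
    exact (ENNReal.rpow_lt_top_iff_of_pos hp').1 hx

lemma ae_lt_top_of_lorentzFunctional_ne_top (hp : p ≠ 0) (hg : lorentzFunctional μ g P p ≠ ⊤) :
    ∀ᵐ x ∂μ, g x < ⊤ := by
  have weighted_lt_top := ae_lt_top_of_eLpNorm_ne_top
    (measurable_weight_mul_measureRearrangement μ g _).aemeasurable hp hg
  refine measure_eq_zero_of_ae_measureRearrangement_lt (g := g) ?_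
  filter_upwards [weighted_lt_top, self_mem_ae_restrict measurableSet_Ioi]
    with t ht hpos x (hx : ¬g x < ⊤)
  rw [not_lt_top_iff.1 hx]
  exact ENNReal.lt_top_of_mul_ne_top_right ht.ne
    (ENNReal.ofReal_pos.2 (Real.rpow_pos_of_pos hpos _)).ne'

lemma ae_eq_zero_of_lorentzFunctional_eq_zero (hp : p ≠ 0) (hg : lorentzFunctional μ g P p = 0) :
    g =ᵐ[μ] 0 := by
  have weighted_eq_zero := (eLpNorm_eq_zero_iff
    (measurable_weight_mul_measureRearrangement μ g _).aestronglyMeasurable hp).1 hg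
  refine measure_eq_zero_of_ae_measureRearrangement_lt (g := g) ?_
  filter_upwards [weighted_eq_zero, self_mem_ae_restrict measurableSet_Ioi] with t ht hpos x hx
  rw [(mul_eq_zero.1 ht).resolve_left (ENNReal.ofReal_pos.2 (Real.rpow_pos_of_pos hpos _)).ne']
  exact pos_iff_ne_zero.2 hx

lemma lorentzFunctional_eq_zero_of_ae_eq_zero (hg : g =ᵐ[μ] 0) (P p : ℝ≥0∞) :
    lorentzFunctional μ g P p = 0 := by
  have rearrangement_eq_zero (t : ℝ) : measureRearrangement μ g t = 0 := by
    refine nonpos_iff_eq_zero.1 (measureRearrangement_le_iff.2 ?_)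
    have : μ {x | 0 < g x} = 0 := by simpa [ae_iff, pos_iff_ne_zero] using ae_iff.1 hg
    simp [this]
  simp [lorentzFunctional, rearrangement_eq_zero]

lemma eLpNorm_comp_mul_left (f : ℝ → ℝ≥0∞) {c : ℝ} (hc : 0 < c) (p : ℝ≥0∞) :
    eLpNorm (fun t => f (c * t)) p (volume.restrict (Ioi 0))
      = ENNReal.ofReal c⁻¹ ^ (1 / p).toReal * eLpNorm f p (volume.restrict (Ioi 0)) := by
  have embedding : MeasurableEmbedding (c * · : ℝ → ℝ) :=
    (Homeomorph.mulLeft₀ c hc.ne').measurableEmbedding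
  have preimage_Ioi : (c * · : ℝ → ℝ) ⁻¹' Ioi 0 = Ioi 0 := by
    ext t
    simp [hc]
  have map_restrict : Measure.map (c * ·) (volume.restrict (Ioi (0 : ℝ)))
      = ENNReal.ofReal c⁻¹ • volume.restrict (Ioi 0) := by
    rw [← preimage_Ioi, ← embedding.restrict_map, preimage_Ioi, Real.map_volume_mul_left hc.ne',
      abs_of_pos (inv_pos.2 hc), Measure.restrict_smul]
  have := embedding.eLpNorm_map_measure (p := p) (μ := volume.restrict (Ioi 0)) (g := f)
  rw [map_restrict, eLpNorm_smul_measure_of_ne_zero (by simpa using hc)] at this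
  exact this.symm

lemma eLpNorm_weight_mul_comp_mul_left {f : ℝ → ℝ≥0∞} (hf : Measurable f) {c : ℝ} (hc : 0 < c)
    (a : ℝ) (p : ℝ≥0∞) :
    eLpNorm (fun t => ENNReal.ofReal (t ^ a) * f (c * t)) p (volume.restrict (Ioi 0))
      = ENNReal.ofReal (c ^ (-(a + (1 / p).toReal))) *
        eLpNorm (fun t => ENNReal.ofReal (t ^ a) * f t) p (volume.restrict (Ioi 0)) := by
  calc
    _ = eLpNorm (fun t => ENNReal.ofReal (c ^ (-a)) * (ENNReal.ofReal ((c * t) ^ a) * f (c * t))) p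
        (volume.restrict (Ioi 0)) := by
      refine eLpNorm_congr_ae ?_
      filter_upwards [self_mem_ae_restrict measurableSet_Ioi] with t (ht : 0 < t)
      rw [← mul_assoc, ← ENNReal.ofReal_mul (by positivity), Real.mul_rpow hc.le ht.le,
        ← mul_assoc, ← Real.rpow_add hc, neg_add_cancel, Real.rpow_zero, one_mul]
    _ = _ := by
      rw [eLpNorm_const_mul_ennreal _ (by fun_prop),
        eLpNorm_comp_mul_left (fun t => ENNReal.ofReal (t ^ a) * f t) hc, ← mul_assoc,
        ENNReal.ofReal_rpow_of_pos (by positivity), ← ENNReal.ofReal_mul (by positivity),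
        Real.inv_rpow hc.le, ← Real.rpow_neg hc.le, ← Real.rpow_add hc, neg_add]

lemma toReal_one_div_eq_of_eq {θ η : ℝ} (hθ : 0 ≤ θ) (hη : 0 ≤ η) {p q r : ℝ≥0∞} (hp : p ≠ 0)
    (hpqr : 1 / p = ENNReal.ofReal θ / r + ENNReal.ofReal η / q) :
    (1 / p).toReal = θ * (1 / r).toReal + η * (1 / q).toReal := by
  have sum_ne_top : ENNReal.ofReal θ / r + ENNReal.ofReal η / q ≠ ⊤ := by
    rw [← hpqr, one_div]
    exact ENNReal.inv_ne_top.2 hp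
  rw [hpqr, ENNReal.toReal_add (ENNReal.add_ne_top.1 sum_ne_top).1
    (ENNReal.add_ne_top.1 sum_ne_top).2]
  simp [div_eq_mul_inv, hθ, hη]

lemma ofReal_rpow_mul_rpow_mul_rpow {t : ℝ} (ht : 0 < t) {θ η : ℝ} (hθ : 0 ≤ θ) (hη : 0 ≤ η)
    (a b : ℝ) (x y : ℝ≥0∞) :
    ENNReal.ofReal (t ^ (θ * a + η * b)) * (x ^ θ * y ^ η) =
      (ENNReal.ofReal (t ^ a) * x) ^ θ * (ENNReal.ofReal (t ^ b) * y) ^ η := by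
  rw [ENNReal.mul_rpow_of_nonneg _ _ hθ, ENNReal.mul_rpow_of_nonneg _ _ hη, mul_mul_mul_comm,
    ENNReal.ofReal_rpow_of_pos (by positivity), ENNReal.ofReal_rpow_of_pos (by positivity),
    ← ENNReal.ofReal_mul (by positivity), ← Real.rpow_mul ht.le, ← Real.rpow_mul ht.le,
    ← Real.rpow_add ht, mul_comm a, mul_comm b]

lemma lorentzFunctional_le_of_ae_le_mul_rpow {H A B : α → ℝ≥0∞} {c : ℝ≥0∞}
    {θ η : ℝ} (hθ : 0 < θ) (hη : 0 < η) {P Q R p q r : ℝ≥0∞} (hP : P ≠ 0) (hp : p ≠ 0)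
    (hPQR : 1 / P = ENNReal.ofReal θ / R + ENNReal.ofReal η / Q)
    (hpqr : 1 / p = ENNReal.ofReal θ / r + ENNReal.ofReal η / q)
    (hH : ∀ᵐ x ∂μ, H x ≤ c * (A x ^ θ * B x ^ η)) :
    lorentzFunctional μ H P p ≤ c * ENNReal.ofReal (2⁻¹ ^ (-(1 / P).toReal)) *
      (lorentzFunctional μ A R r ^ θ * lorentzFunctional μ B Q q ^ η) := by
  let a := (1 / P).toReal - (1 / p).toReal
  let F := fun s => measureRearrangement μ A s ^ θ * measureRearrangement μ B s ^ η
  have measurable_F : Measurable F :=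
    ((measureRearrangement_antitone μ A).measurable.pow_const θ).mul
      ((measureRearrangement_antitone μ B).measurable.pow_const η)
  have rearrangement_le : lorentzFunctional μ H P p ≤
      eLpNorm (fun t : ℝ => c * (ENNReal.ofReal (t ^ a) * F (2⁻¹ * t))) p
        (volume.restrict (Ioi 0)) := by
    refine eLpNorm_mono_enorm fun t => ?_
    rw [enorm_eq_self, enorm_eq_self, mul_left_comm]
    gcongr
    exact (measureRearrangement_mono_ae hH t).trans
      (measureRearrangement_mul_rpow_le A B c hθ.le hη.le t)
  have weight_split : ∀ᵐ t ∂volume.restrict (Ioi (0 : ℝ)), ENNReal.ofReal (t ^ a) * F t =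
      (ENNReal.ofReal (t ^ ((1 / R).toReal - (1 / r).toReal)) * measureRearrangement μ A t) ^ θ *
        (ENNReal.ofReal (t ^ ((1 / Q).toReal - (1 / q).toReal)) *
          measureRearrangement μ B t) ^ η := by
    filter_upwards [self_mem_ae_restrict measurableSet_Ioi] with t (ht : 0 < t)
    rw [← ofReal_rpow_mul_rpow_mul_rpow ht hθ.le hη.le]
    congr 3
    simp only [a, toReal_one_div_eq_of_eq hθ.le hη.le hP hPQR,
      toReal_one_div_eq_of_eq hθ.le hη.le hp hpqr]
    ring
  refine rearrangement_le.trans ?_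
  rw [eLpNorm_const_mul_ennreal _ (by fun_prop),
    eLpNorm_weight_mul_comp_mul_left measurable_F (by norm_num), mul_assoc, sub_add_cancel,
    eLpNorm_congr_ae weight_split]
  gcongr
  exact eLpNorm_rpow_mul_rpow_le (measurable_weight_mul_measureRearrangement μ A _).aemeasurable
    (measurable_weight_mul_measureRearrangement μ B _).aemeasurable hθ hη hpqr

/-- The constant of the dyadic Hardy inequality: it bounds the operator `f ↦ ∑ᵢ 2⁻ⁱ f (2⁻ⁱ⁻¹ t)`
on `Lᵖ(0, ∞)` with weight `t ^ (s - 1/p)`. It is infinite for `s ≥ 1`. -/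
noncomputable def hardyConst (s : ℝ) : ℝ≥0∞ :=
  ∑' i : ℕ, ENNReal.ofReal (2⁻¹ ^ i) * ENNReal.ofReal ((2⁻¹ ^ (i + 1)) ^ (-s))

lemma hardyConst_ne_top {s : ℝ} (hs : s < 1) : hardyConst s ≠ ⊤ := by
  have term_eq (i : ℕ) : ENNReal.ofReal (2⁻¹ ^ i) * ENNReal.ofReal ((2⁻¹ ^ (i + 1)) ^ (-s))
      = ENNReal.ofReal ((2⁻¹ : ℝ) ^ (-s)) * ENNReal.ofReal ((2⁻¹ : ℝ) ^ (1 - s)) ^ i := by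
    rw [← ENNReal.ofReal_mul (by positivity), ← ENNReal.ofReal_pow (by positivity),
      ← ENNReal.ofReal_mul (by positivity), ← Real.rpow_natCast_mul (by norm_num),
      ← Real.rpow_mul_natCast (by norm_num), ← Real.rpow_natCast, ← Real.rpow_add (by norm_num),
      ← Real.rpow_add (by norm_num)]
    push_cast
    ring_nf
  have ratio_lt_one : ENNReal.ofReal ((2⁻¹ : ℝ) ^ (1 - s)) < 1 :=
    ENNReal.ofReal_lt_one.2 (Real.rpow_lt_one (by norm_num) (by norm_num) (by linarith))
  simp only [hardyConst, term_eq]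
  rw [ENNReal.tsum_mul_left, ENNReal.tsum_geometric]
  exact ENNReal.mul_ne_top ENNReal.ofReal_ne_top
    (ENNReal.inv_ne_top.2 (tsub_pos_of_lt ratio_lt_one).ne')

lemma lorentzFunctional_le_of_measureRearrangement_le_tsum {G : β → ℝ≥0∞} {K : ℝ≥0∞} (P : ℝ≥0∞)
    (hp : 1 ≤ p)
    (hG : ∀ t > 0, measureRearrangement ν G t ≤
      K * ∑' i : ℕ, ENNReal.ofReal (2⁻¹ ^ i) * measureRearrangement μ g (2⁻¹ ^ (i + 1) * t)) :
    lorentzFunctional ν G P p ≤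
      K * hardyConst (1 / P).toReal * lorentzFunctional μ g P p := by
  let a := (1 / P).toReal - (1 / p).toReal
  have measurable_g := (measureRearrangement_antitone μ g).measurable
  calc
    lorentzFunctional ν G P p
      ≤ eLpNorm (fun t : ℝ => K * ∑' i : ℕ, (ENNReal.ofReal (2⁻¹ ^ i) *
          (ENNReal.ofReal (t ^ a) * measureRearrangement μ g (2⁻¹ ^ (i + 1) * t)))) p
          (volume.restrict (Ioi 0)) := by
      refine eLpNorm_mono_enorm_ae ?_
      filter_upwards [self_mem_ae_restrict measurableSet_Ioi] with t ht
      simp only [enorm_eq_self, mul_left_comm _ (ENNReal.ofReal (t ^ a)), ENNReal.tsum_mul_left]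
      exact mul_le_mul_right (hG t ht) _
    _ ≤ K * ∑' i : ℕ, ENNReal.ofReal (2⁻¹ ^ i) * eLpNorm (fun t : ℝ =>
          ENNReal.ofReal (t ^ a) * measureRearrangement μ g (2⁻¹ ^ (i + 1) * t)) p
          (volume.restrict (Ioi 0)) := by
      rw [eLpNorm_const_mul_ennreal _ (by fun_prop)]
      gcongr
      refine (eLpNorm_tsum_le (fun i => by fun_prop) hp).trans_eq (tsum_congr fun i => ?_)
      exact eLpNorm_const_mul_ennreal _ (by fun_prop) p
    _ = K * hardyConst (1 / P).toReal * lorentzFunctional μ g P p := by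
      rw [hardyConst, mul_assoc, ← ENNReal.tsum_mul_right]
      congr! 3 with i
      rw [eLpNorm_weight_mul_comp_mul_left measurable_g (by positivity), sub_add_cancel, mul_assoc]
      rfl

lemma le_tsum_indicator_of_exists_le {l : ℕ → ℝ≥0∞} {y : ℝ≥0∞} (h0 : l 0 < y)
    (hy : ∃ i, y ≤ l i) : y ≤ ∑' i, (Ioi (l i)).indicator (fun _ => l (i + 1)) y := by
  obtain ⟨i, lt_y, y_le⟩ : ∃ i, l i < y ∧ y ≤ l (i + 1) := by
    by_contra! hcon
    obtain ⟨i, hi⟩ := hy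
    exact hi.not_gt (Nat.rec h0 hcon i)
  calc y ≤ (Ioi (l i)).indicator (fun _ => l (i + 1)) y := by
        rwa [indicator_of_mem (mem_Ioi.2 lt_y)]
    _ ≤ _ := ENNReal.le_tsum i

lemma ae_exists_le_measureRearrangement (μ : Measure α) (g : α → ℝ≥0∞) (t : ℝ) :
    ∀ᵐ x ∂μ, ∃ i : ℕ, g x ≤ measureRearrangement μ g (2⁻¹ ^ i * t) := by
  have tendsto_zero : Tendsto (fun i : ℕ => ENNReal.ofReal (2⁻¹ ^ i * t)) atTop (𝓝 0) := by
    simpa using ENNReal.tendsto_ofReal ((tendsto_pow_atTop_nhds_zero_of_lt_one (by norm_num)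
      (by norm_num : (2⁻¹ : ℝ) < 1)).mul_const t)
  refine nonpos_iff_eq_zero.1 (ge_of_tendsto' tendsto_zero fun i => ?_)
  refine (measure_mono fun x hx => ?_).trans (measure_measureRearrangement_lt_le μ g (2⁻¹ ^ i * t))
  exact not_le.1 fun hle => hx ⟨i, hle⟩

lemma setLIntegral_measureRearrangement_lt_le (hg : AEMeasurable g μ) (t : ℝ) :
    ∫⁻ x in {x | measureRearrangement μ g t < g x}, g x ∂μ ≤
      ENNReal.ofReal t *
        ∑' i : ℕ, ENNReal.ofReal (2⁻¹ ^ i) * measureRearrangement μ g (2⁻¹ ^ (i + 1) * t) := by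
  let l (i : ℕ) : ℝ≥0∞ := measureRearrangement μ g (2⁻¹ ^ i * t)
  have nullMeasurable_lt (s : ℝ≥0∞) : NullMeasurableSet {x | s < g x} μ :=
    nullMeasurableSet_lt aemeasurable_const hg
  calc
    _ ≤ ∫⁻ x in {x | measureRearrangement μ g t < g x},
          ∑' i, (Ioi (l i)).indicator (fun _ => l (i + 1)) (g x) ∂μ := by
      refine lintegral_mono_ae ?_
      filter_upwards [ae_restrict_mem₀ (nullMeasurable_lt _),
        ae_restrict_of_ae (ae_exists_le_measureRearrangement μ g t)] with x hlt hle
      exact le_tsum_indicator_of_exists_le (by simpa [l] using hlt) hle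
    _ ≤ ∑' i, ∫⁻ x, {x | l i < g x}.indicator (fun _ => l (i + 1)) x ∂μ := by
      rw [← lintegral_tsum fun i => aemeasurable_const.indicator₀ (nullMeasurable_lt _)]
      exact setLIntegral_le_lintegral _ _
    _ ≤ ∑' i, l (i + 1) * ENNReal.ofReal (2⁻¹ ^ i * t) := by
      gcongr with i
      rw [lintegral_indicator_const₀ (nullMeasurable_lt _)]
      gcongr
      exact measure_measureRearrangement_lt_le μ g _
    _ = _ := by
      rw [← ENNReal.tsum_mul_left]
      refine tsum_congr fun i => ?_
      rw [ENNReal.ofReal_mul (by positivity)]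
      ring

end Rearrangement

section MaximalFunction

open Module (finrank)

lemma lowerSemicontinuous_measure_ball {X : Type*} [PseudoMetricSpace X] [MeasurableSpace X]
    (ν : Measure X) (r : ℝ) : LowerSemicontinuous fun x => ν (ball x r) := by
  intro x c (hc : c < ν (ball x r))
  obtain ⟨s, s_mono, s_lt, s_tendsto⟩ := exists_seq_strictMono_tendsto r
  have ball_eq : ball x r = ⋃ i, ball x (s i) := by
    refine Subset.antisymm (fun y hy => ?_)
      (iUnion_subset fun i => ball_subset_ball (s_lt i).le)
    exact mem_iUnion.2 (s_tendsto.eventually_const_lt (mem_ball.1 hy)).exists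
  have ball_mono : Monotone fun i => ball x (s i) := fun i i' h =>
    ball_subset_ball (s_mono.monotone h)
  rw [ball_eq, ball_mono.measure_iUnion] at hc
  obtain ⟨i, hi⟩ := lt_iSup_iff.1 hc
  filter_upwards [ball_mem_nhds x (sub_pos.2 (s_lt i))] with y hy
  refine hi.trans_le (measure_mono (ball_subset_ball' ?_))
  linarith [mem_ball'.1 hy]

variable {E : Type*} [NormedAddCommGroup E] [MeasurableSpace E] {μ : Measure E} {g h : E → ℝ≥0∞}

/-- The centred Hardy–Littlewood maximal function. -/
noncomputable def maximalFunction (μ : Measure E) (g : E → ℝ≥0∞) (x : E) : ℝ≥0∞ :=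
  ⨆ (r : ℝ) (_ : 0 < r), ⨍⁻ y in ball x r, g y ∂μ

lemma maximalFunction_mono_ae (hgh : g ≤ᵐ[μ] h) (x : E) :
    maximalFunction μ g x ≤ maximalFunction μ h x :=
  iSup₂_mono fun _ _ => lintegral_mono_ae <|
    Measure.ae_smul_measure (ae_restrict_of_ae hgh) _

lemma maximalFunction_const_mul {c : ℝ≥0∞} (hc : c ≠ ⊤) (g : E → ℝ≥0∞) (x : E) :
    maximalFunction μ (fun y => c * g y) x = c * maximalFunction μ g x := by
  simp only [maximalFunction, laverage, lintegral_const_mul' _ _ hc, ENNReal.mul_iSup]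

section BorelSpace

variable [BorelSpace E] [μ.IsAddHaarMeasure]

lemma measurable_maximalFunction (g : E → ℝ≥0∞) : Measurable (maximalFunction μ g) := by
  have eq_iSup : maximalFunction μ g = fun x =>
      ⨆ (r : ℝ) (_ : 0 < r), ((μ (ball 0 r))⁻¹ • μ.withDensity g) (ball x r) := by
    ext x
    simp only [maximalFunction, setLAverage_eq, Measure.addHaar_ball_center μ x,
      Measure.smul_apply, withDensity_apply g measurableSet_ball, smul_eq_mul, div_eq_mul_inv,
      mul_comm]
  rw [eq_iSup]
  exact (lowerSemicontinuous_biSup fun r _ => lowerSemicontinuous_measure_ball _ r).measurable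

end BorelSpace

variable [NormedSpace ℝ E] [FiniteDimensional ℝ E] [μ.IsAddHaarMeasure]

lemma setLIntegral_ball_le_maximalFunction (g : E → ℝ≥0∞) (x : E) {r : ℝ} (hr : 0 < r) :
    ∫⁻ y in ball x r, g y ∂μ ≤ μ (ball x r) * maximalFunction μ g x := by
  rw [← measure_mul_setLAverage g measure_ball_lt_top.ne]
  gcongr
  exact le_iSup₂ (f := fun r (_ : 0 < r) => ⨍⁻ y in ball x r, g y ∂μ) r hr

lemma maximalFunction_const_add_le (c : ℝ≥0∞) (g : E → ℝ≥0∞) (x : E) :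
    maximalFunction μ (fun y => c + g y) x ≤ c + maximalFunction μ g x := by
  refine iSup₂_le fun r hr => ?_
  have : IsFiniteMeasure (μ.restrict (ball x r)) := ⟨by simp [measure_ball_lt_top]⟩
  have : NeZero (μ.restrict (ball x r)) := ⟨by
    simpa using (measure_ball_pos μ x hr).ne'⟩
  calc ⨍⁻ y in ball x r, (c + g y) ∂μ = c + ⨍⁻ y in ball x r, g y ∂μ := by
        rw [laverage, lintegral_add_left measurable_const, ← laverage, ← laverage, laverage_const]
    _ ≤ _ := by
        gcongr
        exact le_iSup₂ (f := fun r (_ : 0 < r) => ⨍⁻ y in ball x r, g y ∂μ) r hr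

variable [BorelSpace E]

lemma setLIntegral_ball_comp_affine_le (g : E → ℝ≥0∞) (x : E) {s ρ : ℝ} (hs : 0 < s) (hρ : 0 < ρ) :
    ∫⁻ y in ball 0 ρ, g (x + s • y) ∂μ ≤ μ (ball 0 ρ) * maximalFunction μ g x := by
  let T : E ≃ₜ E := (Homeomorph.smulOfNeZero s hs.ne').trans (Homeomorph.addLeft x)
  have preimage_ball : T ⁻¹' ball x (s * ρ) = ball 0 ρ := by
    ext y
    simp [T, mem_ball, dist_eq_norm, norm_smul, abs_of_pos hs, hs]
  have map_eq : μ.map T = ENNReal.ofReal |(s ^ finrank ℝ E)⁻¹| • μ := by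
    have := Measure.map_map (μ := μ) (measurable_const_add x) (measurable_const_smul s)
    rw [Measure.map_addHaar_smul μ hs.ne', Measure.map_smul, map_add_left_eq_self] at this
    exact this.symm
  have map_ball : μ.map T (ball x (s * ρ)) = μ (ball 0 ρ) := by
    rw [T.measurableEmbedding.map_apply, preimage_ball]
  calc ∫⁻ y in ball 0 ρ, g (T y) ∂μ = ∫⁻ z in ball x (s * ρ), g z ∂μ.map T := by
        rw [T.measurableEmbedding.restrict_map, T.measurableEmbedding.lintegral_map,
          preimage_ball]
    _ ≤ μ.map T (ball x (s * ρ)) * maximalFunction μ g x := by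
        rw [map_eq, Measure.restrict_smul, lintegral_smul_measure, Measure.smul_apply,
          smul_mul_assoc]
        gcongr
        exact setLIntegral_ball_le_maximalFunction g x (mul_pos hs hρ)
    _ = _ := by rw [map_ball]

lemma exists_lintegral_enorm_mul_comp_affine_le {ψ : E → ℝ} (hψ : Continuous ψ)
    (hψc : HasCompactSupport ψ) :
    ∃ K : ℝ≥0, ∀ (g : E → ℝ≥0∞) (x : E) (s : ℝ), 0 < s →
      ∫⁻ y, ‖ψ y‖ₑ * g (x + s • y) ∂μ ≤ K * maximalFunction μ g x := by
  obtain ⟨B, hB⟩ := hψ.bounded_above_of_compact_support hψc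
  obtain ⟨ρ, hρ, support_subset⟩ := hψc.isCompact.isBounded.subset_ball_lt 0 0
  lift ENNReal.ofReal B * μ (ball 0 ρ) to ℝ≥0 using
    ENNReal.mul_ne_top ENNReal.ofReal_ne_top measure_ball_lt_top.ne with K hK
  refine ⟨K, fun g x s hs => ?_⟩
  calc ∫⁻ y, ‖ψ y‖ₑ * g (x + s • y) ∂μ
      = ∫⁻ y in ball 0 ρ, ‖ψ y‖ₑ * g (x + s • y) ∂μ := by
        refine (setLIntegral_eq_of_support_subset fun y hy => support_subset ?_).symm
        exact subset_tsupport ψ (enorm_ne_zero.1 (left_ne_zero_of_mul hy))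
    _ ≤ ∫⁻ y in ball 0 ρ, ENNReal.ofReal B * g (x + s • y) ∂μ := by
        gcongr with y
        rw [← ofReal_norm]
        exact ENNReal.ofReal_le_ofReal (hB y)
    _ = ENNReal.ofReal B * ∫⁻ y in ball 0 ρ, g (x + s • y) ∂μ :=
        lintegral_const_mul' _ _ ENNReal.ofReal_ne_top
    _ ≤ ENNReal.ofReal B * (μ (ball 0 ρ) * maximalFunction μ g x) := by
        gcongr
        exact setLIntegral_ball_comp_affine_le g x hs hρ
    _ = K * maximalFunction μ g x := by rw [hK, mul_assoc]

lemma enorm_normed_le_div_measure_ball (b : ContDiffBump (0 : E)) {K : ℝ}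
    (hK : b.rOut ≤ K * b.rIn) (x z : E) :
    ‖b.normed μ z‖ₑ ≤ ENNReal.ofReal (K ^ finrank ℝ E) / μ (ball x b.rOut) := by
  have closedBall_pos : 0 < μ.real (closedBall 0 b.rOut) :=
    ENNReal.toReal_pos (measure_closedBall_pos μ 0 b.rOut_pos).ne' measure_closedBall_lt_top.ne
  rw [Real.enorm_of_nonneg (b.nonneg_normed z)]
  calc ENNReal.ofReal (b.normed μ z)
      ≤ ENNReal.ofReal (K ^ finrank ℝ E / μ.real (closedBall 0 b.rOut)) :=
        ENNReal.ofReal_le_ofReal (b.normed_le_div_measure_closedBall_rOut μ K hK z)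
    _ = ENNReal.ofReal (K ^ finrank ℝ E) / μ (closedBall 0 b.rOut) := by
        rw [ENNReal.ofReal_div_of_pos closedBall_pos,
          ofReal_measureReal measure_closedBall_lt_top.ne]
    _ ≤ ENNReal.ofReal (K ^ finrank ℝ E) / μ (ball x b.rOut) := by
        rw [Measure.addHaar_ball_center]
        gcongr
        exact ball_subset_closedBall

open scoped Convolution in
lemma enorm_convolution_normed_le {F : Type*} [NormedAddCommGroup F] [NormedSpace ℝ F]
    (b : ContDiffBump (0 : E)) {K : ℝ} (hK : b.rOut ≤ K * b.rIn) (g : E → F) (x : E) :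
    ‖(b.normed μ ⋆[ContinuousLinearMap.lsmul ℝ ℝ, μ] g) x‖ₑ ≤
      ENNReal.ofReal (K ^ finrank ℝ E) * maximalFunction μ (fun y => ‖g y‖ₑ) x := by
  set B := ball x b.rOut
  have measure_ne_zero : μ B ≠ 0 := (measure_ball_pos μ x b.rOut_pos).ne'
  have measure_ne_top : μ B ≠ ⊤ := measure_ball_lt_top.ne
  calc ‖(b.normed μ ⋆[ContinuousLinearMap.lsmul ℝ ℝ, μ] g) x‖ₑ
      ≤ ∫⁻ y, ‖b.normed μ (x - y) • g y‖ₑ ∂μ := by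
        rw [convolution_eq_swap]
        exact enorm_integral_le_lintegral_enorm _
    _ = ∫⁻ y in B, ‖b.normed μ (x - y) • g y‖ₑ ∂μ := by
        refine (setLIntegral_eq_of_support_subset fun y hy => ?_).symm
        have : x - y ∈ Function.support (b.normed μ) := left_ne_zero_of_smul (enorm_ne_zero.1 hy)
        rwa [b.support_normed_eq, mem_ball_zero_iff, ← mem_ball_iff_norm'] at this
    _ ≤ ∫⁻ y in B, ENNReal.ofReal (K ^ finrank ℝ E) / μ B * ‖g y‖ₑ ∂μ := by
        gcongr with y
        rw [enorm_smul]
        gcongr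
        exact enorm_normed_le_div_measure_ball b hK x _
    _ ≤ ENNReal.ofReal (K ^ finrank ℝ E) / μ B *
          (μ B * maximalFunction μ (fun y => ‖g y‖ₑ) x) := by
        rw [lintegral_const_mul' _ _ (ENNReal.div_ne_top ENNReal.ofReal_ne_top measure_ne_zero)]
        gcongr
        exact setLIntegral_ball_le_maximalFunction _ x b.rOut_pos
    _ = _ := by rw [← mul_assoc, ENNReal.div_mul_cancel measure_ne_zero measure_ne_top]

lemma mul_measure_centers_le (g : E → ℝ≥0∞) (s : ℝ≥0∞) (R : ℝ) :
    s * μ {x | ∃ r, 0 < r ∧ r ≤ R ∧ s * μ (ball x r) ≤ ∫⁻ y in ball x r, g y ∂μ} ≤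
      ENNReal.ofReal (4 ^ finrank ℝ E) * ∫⁻ y, g y ∂μ := by
  let t : Set (E × ℝ) :=
    {b | 0 < b.2 ∧ b.2 ≤ R ∧ s * μ (ball b.1 b.2) ≤ ∫⁻ y in ball b.1 b.2, g y ∂μ}
  obtain ⟨u, hut, disjoint_u, covering⟩ :=
    Vitali.exists_disjoint_subfamily_covering_enlargement_ball t Prod.fst Prod.snd R
      (fun b hb => hb.2.1) 4 (by norm_num)
  have countable_u : u.Countable := disjoint_u.countable_of_isOpen (fun _ _ => isOpen_ball)
    fun b hb => nonempty_ball.2 (hut hb).1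
  have subset_biUnion : {x | ∃ r, 0 < r ∧ r ≤ R ∧ s * μ (ball x r) ≤ ∫⁻ y in ball x r, g y ∂μ}
      ⊆ ⋃ b ∈ u, ball b.1 (4 * b.2) := by
    rintro x ⟨r, hr, hx⟩
    obtain ⟨b, hb, hsub⟩ := covering (x, r) ⟨hr, hx⟩
    exact mem_biUnion hb (hsub (mem_ball_self hr))
  calc
    _ ≤ s * ∑' b : u, μ (ball b.1.1 (4 * b.1.2)) := by
      gcongr
      exact (measure_mono subset_biUnion).trans (measure_biUnion_le _ countable_u _)
    _ = ENNReal.ofReal (4 ^ finrank ℝ E) * ∑' b : u, s * μ (ball b.1.1 b.1.2) := by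
      rw [← ENNReal.tsum_mul_left, ← ENNReal.tsum_mul_left]
      refine tsum_congr fun b => ?_
      rw [Measure.addHaar_ball_mul_of_pos μ _ four_pos, ← Measure.addHaar_ball_center μ b.1.1,
        mul_left_comm]
    _ ≤ ENNReal.ofReal (4 ^ finrank ℝ E) * ∑' b : u, ∫⁻ y in ball b.1.1 b.1.2, g y ∂μ := by
      gcongr with b
      exact (hut b.2).2.2
    _ = ENNReal.ofReal (4 ^ finrank ℝ E) * ∫⁻ y in ⋃ b ∈ u, ball b.1 b.2, g y ∂μ := by
      rw [lintegral_biUnion countable_u (fun _ _ => measurableSet_ball) disjoint_u]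
    _ ≤ _ := by
      gcongr
      exact Measure.restrict_le_self

lemma mul_measure_lt_maximalFunction_le (g : E → ℝ≥0∞) (s : ℝ≥0∞) :
    s * μ {x | s < maximalFunction μ g x} ≤
      ENNReal.ofReal (4 ^ finrank ℝ E) * ∫⁻ y, g y ∂μ := by
  let U (N : ℕ) : Set E :=
    {x | ∃ r : ℝ, 0 < r ∧ r ≤ N ∧ s * μ (ball x r) ≤ ∫⁻ y in ball x r, g y ∂μ}
  have subset_iUnion : {x | s < maximalFunction μ g x} ⊆ ⋃ N, U N := by
    intro x hx
    obtain ⟨r, hr, s_lt⟩ : ∃ r, ∃ _ : 0 < r, s < ⨍⁻ y in ball x r, g y ∂μ := by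
      rw [mem_ofPred_eq, maximalFunction] at hx
      simpa only [lt_iSup_iff] using hx
    obtain ⟨N, hN⟩ := exists_nat_ge r
    refine mem_iUnion.2 ⟨N, r, hr, hN, ?_⟩
    rw [mul_comm, ← measure_mul_setLAverage g measure_ball_lt_top.ne]
    gcongr
  have monotone_U : Monotone U := by
    rintro a b hab x ⟨r, hr, hra, hx⟩
    exact ⟨r, hr, hra.trans (Nat.cast_le.2 hab), hx⟩
  calc s * μ {x | s < maximalFunction μ g x} ≤ s * μ (⋃ N, U N) := by gcongr
    _ = ⨆ N, s * μ (U N) := by rw [monotone_U.measure_iUnion, ENNReal.mul_iSup]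
    _ ≤ _ := iSup_le fun N => mul_measure_centers_le g s N

lemma measureRearrangement_maximalFunction_le (hg : AEMeasurable g μ) {t : ℝ} (ht : 0 < t) :
    measureRearrangement μ (maximalFunction μ g) t ≤ (1 + ENNReal.ofReal (4 ^ finrank ℝ E)) *
      ∑' i : ℕ, ENNReal.ofReal (2⁻¹ ^ i) * measureRearrangement μ g (2⁻¹ ^ (i + 1) * t) := by
  let c := measureRearrangement μ g t
  let tail := {x | c < g x}.indicator g
  let S := ∑' i : ℕ, ENNReal.ofReal (2⁻¹ ^ i) * measureRearrangement μ g (2⁻¹ ^ (i + 1) * t)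
  have lintegral_tail_le : ∫⁻ x, tail x ∂μ ≤ ENNReal.ofReal t * S := by
    rw [lintegral_indicator₀ (nullMeasurableSet_lt aemeasurable_const hg)]
    exact setLIntegral_measureRearrangement_lt_le hg t
  have le_const_add_tail (y : E) : g y ≤ c + tail y := by
    by_cases hy : c < g y
    · simp [tail, indicator_of_mem (s := {x | c < g x}) hy g]
    · exact (not_lt.1 hy).trans le_self_add
  have c_le : c ≤ S := by
    refine le_trans ?_ (ENNReal.le_tsum 0)
    rw [pow_zero, ENNReal.ofReal_one, one_mul]
    exact measureRearrangement_antitone μ g (by norm_num; linarith)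
  have tail_rearrangement_le : measureRearrangement μ (maximalFunction μ tail) t ≤
      ENNReal.ofReal (4 ^ finrank ℝ E) * S := by
    refine (measureRearrangement_le_of_weak_type
      (mul_measure_lt_maximalFunction_le tail) ht).trans ?_
    refine ENNReal.div_le_of_le_mul ?_
    rw [mul_assoc, mul_comm S]
    gcongr
  calc measureRearrangement μ (maximalFunction μ g) t
      ≤ measureRearrangement μ (fun x => c + maximalFunction μ tail x) t :=
        measureRearrangement_mono_ae (ae_of_all _ fun x =>
          (maximalFunction_mono_ae (ae_of_all _ le_const_add_tail) x).trans
            (maximalFunction_const_add_le c tail x)) t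
    _ ≤ c + measureRearrangement μ (maximalFunction μ tail) t :=
        measureRearrangement_const_add_le c _ t
    _ ≤ S + ENNReal.ofReal (4 ^ finrank ℝ E) * S := add_le_add c_le tail_rearrangement_le
    _ = _ := by rw [add_mul, one_mul]

variable (μ) in
lemma exists_lorentzFunctional_maximalFunction_le {P p : ℝ≥0∞} (hP : 1 < P) (hp : 1 ≤ p) :
    ∃ C : ℝ≥0, ∀ g : E → ℝ≥0∞, AEMeasurable g μ →
      lorentzFunctional μ (maximalFunction μ g) P p ≤ C * lorentzFunctional μ g P p := by
  have exponent_lt_one : (1 / P).toReal < 1 := by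
    rw [one_div]
    exact ENNReal.toReal_lt_of_lt_ofReal (by simpa using hP)
  lift (1 + ENNReal.ofReal (4 ^ finrank ℝ E)) * hardyConst (1 / P).toReal to ℝ≥0 using
    ENNReal.mul_ne_top (by simp) (hardyConst_ne_top exponent_lt_one) with C hC
  refine ⟨C, fun g hg => hC ▸ ?_⟩
  exact lorentzFunctional_le_of_measureRearrangement_le_tsum P hp fun t ht =>
    measureRearrangement_maximalFunction_le hg ht

variable (μ) in
lemma exists_lorentzFunctional_maximalFunction_maximalFunction_le {P p : ℝ≥0∞} (hP : 1 < P)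
    (hp : 1 ≤ p) :
    ∃ C : ℝ≥0, ∀ g : E → ℝ≥0∞, AEMeasurable g μ →
      lorentzFunctional μ (maximalFunction μ (maximalFunction μ g)) P p ≤
        C * lorentzFunctional μ g P p := by
  obtain ⟨C, hC⟩ := exists_lorentzFunctional_maximalFunction_le μ hP hp
  refine ⟨C * C, fun g hg => (hC _ (measurable_maximalFunction g).aemeasurable).trans ?_⟩
  rw [ENNReal.coe_mul, mul_assoc]
  gcongr
  exact hC g hg

end MaximalFunction

section SmoothFunctions

variable {E F : Type*} [NormedAddCommGroup E] [NormedSpace ℝ E] [NormedAddCommGroup F]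
  [NormedSpace ℝ F] {f : E → F}

lemma differentiable_iteratedFDeriv_of_contDiff (hf : ContDiff ℝ ∞ f) (m : ℕ) :
    Differentiable ℝ (iteratedFDeriv ℝ m f) :=
  hf.differentiable_iteratedFDeriv (by exact_mod_cast WithTop.coe_lt_top _)

lemma iteratedFDeriv_cons_apply (hf : ContDiff ℝ ∞ f) {m : ℕ} (e : E) (v : Fin m → E) (x : E) :
    iteratedFDeriv ℝ (m + 1) f x (Fin.cons e v : Fin (m + 1) → E) =
      fderiv ℝ (fun y => iteratedFDeriv ℝ m f y v) x e := by
  rw [(differentiable_iteratedFDeriv_of_contDiff hf m x).iteratedFDeriv_succ_apply_left',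
    Fin.cons_zero, Fin.tail_cons]

lemma contDiff_fderiv_apply_const (hf : ContDiff ℝ ∞ f) (v : E) :
    ContDiff ℝ ∞ fun x => fderiv ℝ f x v :=
  (hf.fderiv_right (m := ∞) (by simp)).clm_apply contDiff_const

lemma fderiv_fderiv_apply_comm (hf : ContDiff ℝ ∞ f) (v w x : E) :
    fderiv ℝ (fun y => fderiv ℝ f y v) x w = fderiv ℝ (fun y => fderiv ℝ f y w) x v := by
  have differentiableAt_fderiv : DifferentiableAt ℝ (fderiv ℝ f) x :=
    (hf.fderiv_right (m := ∞) (by simp)).differentiable (by simp) x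
  have isSymm : IsSymmSndFDerivAt ℝ f x := hf.contDiffAt.isSymmSndFDerivAt
    (by simpa using WithTop.coe_le_coe.2 (le_top : (2 : ℕ∞) ≤ ⊤))
  rw [fderiv_clm_apply differentiableAt_fderiv (differentiableAt_const v),
    fderiv_clm_apply differentiableAt_fderiv (differentiableAt_const w)]
  simpa using isSymm.eq w v

end SmoothFunctions

section PartialDerivatives

variable {n m : ℕ} {w φ : Eucl n → ℝ}

lemma contDiff_partialDeriv (hφ : ContDiff ℝ ∞ φ) (a : Fin m → Fin n) :
    ContDiff ℝ ∞ (partialDeriv a φ) :=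
  (ContinuousMultilinearMap.apply ℝ (fun _ : Fin m => Eucl n) ℝ
    fun i => EuclideanSpace.single (a i) (1 : ℝ)).contDiff.comp
      (hφ.iteratedFDeriv_right (by exact_mod_cast le_top))

lemma hasCompactSupport_partialDeriv (hφ : HasCompactSupport φ) (a : Fin m → Fin n) :
    HasCompactSupport (partialDeriv a φ) :=
  (hφ.iteratedFDeriv m (𝕜 := ℝ)).comp_left
    (g := fun L : ContinuousMultilinearMap ℝ (fun _ : Fin m => Eucl n) ℝ =>
      L fun i => EuclideanSpace.single (a i) (1 : ℝ)) rfl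

lemma partialDeriv_zero (a : Fin 0 → Fin n) (φ : Eucl n → ℝ) : partialDeriv a φ = φ := by
  ext x
  simp [partialDeriv]

lemma partialDeriv_succ (hφ : ContDiff ℝ ∞ φ) (a : Fin (m + 1) → Fin n) :
    partialDeriv a φ =
      fun x => fderiv ℝ (partialDeriv (Fin.tail a) φ) x (EuclideanSpace.single (a 0) 1) := by
  ext x
  unfold partialDeriv
  rw [← iteratedFDeriv_cons_apply hφ]
  congr 1
  ext1 i
  refine Fin.cases ?_ (fun i => ?_) i <;> simp [Fin.tail]

lemma partialDeriv_fderiv_comm (hφ : ContDiff ℝ ∞ φ) (v : Eucl n) (a : Fin m → Fin n) :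
    partialDeriv a (fun x => fderiv ℝ φ x v) = fun x => fderiv ℝ (partialDeriv a φ) x v := by
  induction m with
  | zero => simp only [partialDeriv_zero]
  | succ m ih =>
    ext x
    rw [partialDeriv_succ (contDiff_fderiv_apply_const hφ v), ih, partialDeriv_succ hφ,
      fderiv_fderiv_apply_comm (contDiff_partialDeriv hφ _)]

lemma integral_mul_fderiv_apply_eq_neg (hw : ContDiff ℝ ∞ w) (hφ : ContDiff ℝ ∞ φ)
    (hφc : HasCompactSupport φ) (v : Eucl n) :
    ∫ x, w x * fderiv ℝ φ x v = -∫ x, fderiv ℝ w x v * φ x :=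
  integral_mul_fderiv_eq_neg_fderiv_mul_of_integrable
    (((contDiff_fderiv_apply_const hw v).continuous.mul
      hφ.continuous).integrable_of_hasCompactSupport hφc.mul_left)
    ((hw.continuous.mul (contDiff_fderiv_apply_const hφ
      v).continuous).integrable_of_hasCompactSupport (hφc.fderiv_apply ℝ v).mul_left)
    ((hw.continuous.mul hφ.continuous).integrable_of_hasCompactSupport hφc.mul_left)
    (fun x _ => hw.differentiable (by simp) x) (fun x _ => hφ.differentiable (by simp) x)

lemma integral_mul_partialDeriv (hw : ContDiff ℝ ∞ w) (hφ : ContDiff ℝ ∞ φ)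
    (hφc : HasCompactSupport φ) (a : Fin m → Fin n) :
    ∫ x, w x * partialDeriv a φ x = (-1 : ℝ) ^ m * ∫ x, partialDeriv a w x * φ x := by
  induction m generalizing w with
  | zero => simp [partialDeriv_zero]
  | succ m ih =>
    rw [partialDeriv_succ hφ, integral_mul_fderiv_apply_eq_neg hw (contDiff_partialDeriv hφ _)
      (hasCompactSupport_partialDeriv hφc _), ih (contDiff_fderiv_apply_const hw _),
      partialDeriv_fderiv_comm hw, partialDeriv_succ hw]
    ring

lemma partialDeriv_comp_affine (hφ : ContDiff ℝ ∞ φ) (a : Fin m → Fin n) (x : Eucl n) (c : ℝ)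
    (y : Eucl n) :
    partialDeriv a (fun z => φ (x + c • z)) y = c ^ m * partialDeriv a φ (x + c • y) := by
  have contDiff_translate : ContDiff ℝ ∞ fun z => φ (x + z) :=
    hφ.comp (contDiff_const.add contDiff_id)
  unfold partialDeriv
  rw [iteratedFDeriv_comp_const_smul (f := fun z => φ (x + z)) c
    (contDiff_translate.of_le (by exact_mod_cast le_top))]
  simp [iteratedFDeriv_comp_add_left]

/-- The classical gradient `∇ᵐ w` as a tensor field; it is meaningful for smooth `w`. -/
noncomputable def classicalGradient (m : ℕ) (w : Eucl n → ℝ) (x : Eucl n) : Tensor n m :=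
  WithLp.toLp 2 fun b => partialDeriv b w x

lemma iteratedFDeriv_apply_eq_sum (w : Eucl n → ℝ) (z : Eucl n) (v : Fin m → Eucl n) :
    iteratedFDeriv ℝ m w z v = ∑ b : Fin m → Fin n, (∏ i, v i (b i)) * partialDeriv b w z := by
  have v_eq (i : Fin m) : v i = ∑ l, v i l • EuclideanSpace.single l (1 : ℝ) := by
    simpa using ((EuclideanSpace.basisFun (Fin n) ℝ).sum_repr (v i)).symm
  conv_lhs => rw [funext v_eq, ContinuousMultilinearMap.map_sum]
  exact Finset.sum_congr rfl fun b _ => ContinuousMultilinearMap.map_smul_univ _ _ _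

lemma norm_toLp_prod (v : Fin m → Eucl n) :
    ‖(WithLp.toLp 2 fun b => ∏ i, v i (b i) : Tensor n m)‖ = ∏ i, ‖v i‖ := by
  simp only [EuclideanSpace.norm_eq, Real.norm_eq_abs, sq_abs]
  rw [← Real.sqrt_prod _ fun _ _ => Finset.sum_nonneg fun _ _ => sq_nonneg _,
    Finset.prod_univ_sum, Fintype.piFinset_univ]
  simp only [Finset.prod_pow]

lemma abs_iteratedFDeriv_apply_le (w : Eucl n → ℝ) (z : Eucl n) (v : Fin m → Eucl n) :
    |iteratedFDeriv ℝ m w z v| ≤ (∏ i, ‖v i‖) * ‖classicalGradient m w z‖ := by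
  rw [iteratedFDeriv_apply_eq_sum, ← norm_toLp_prod]
  refine le_trans (le_of_eq ?_) (abs_real_inner_le_norm _ _)
  simp [PiLp.inner_apply, classicalGradient, mul_comm]

end PartialDerivatives

section FiniteDifferences

variable {F : Type*} [NormedAddCommGroup F]

lemma enorm_le_enorm_fwdDiff_iter_add (f : ℝ → F) (ε : ℝ) (l : ℕ) :
    ‖f 0‖ₑ ≤ ‖(fwdDiff ε)^[l] f 0‖ₑ +
      ∑ i ∈ Finset.range l, (l.choose (i + 1) : ℝ≥0∞) * ‖f ((i + 1 : ℕ) * ε)‖ₑ := by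
  let S := ∑ i ∈ Finset.range l,
    ((-1 : ℤ) ^ (l - (i + 1)) * l.choose (i + 1)) • f (0 + (i + 1) • ε)
  have fwdDiff_eq : (fwdDiff ε)^[l] f 0 - S = (-1 : ℤ) ^ l • f 0 := by
    rw [fwdDiff_iter_eq_sum_shift, Finset.sum_range_succ', add_sub_cancel_left]
    simp
  have enorm_sign (i : ℕ) (z : F) : ‖(-1 : ℤ) ^ i • z‖ₑ = ‖z‖ₑ := by
    rcases neg_one_pow_eq_or ℤ i with h | h <;> simp [h]
  calc ‖f 0‖ₑ = ‖(fwdDiff ε)^[l] f 0 - S‖ₑ := by rw [fwdDiff_eq, enorm_sign]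
    _ ≤ ‖(fwdDiff ε)^[l] f 0‖ₑ + ‖S‖ₑ := enorm_sub_le
    _ ≤ _ := by
      gcongr
      refine (enorm_sum_le _ _).trans (Finset.sum_le_sum fun i _ => ?_)
      rw [mul_smul, enorm_sign, zero_add, nsmul_eq_mul, natCast_zsmul]
      simp only [enorm_eq_nnnorm]
      exact_mod_cast nnnorm_nsmul_le (n := l.choose (i + 1)) (a := f ((i + 1 : ℕ) * ε))

lemma enorm_le_enorm_fwdDiff_iter_add_two_pow_mul {f : ℝ → F} {ε : ℝ} {c : ℝ≥0∞}
    (hf : ∀ i : ℕ, ‖f ((i + 1 : ℕ) * ε)‖ₑ ≤ c) (l : ℕ) :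
    ‖f 0‖ₑ ≤ ‖(fwdDiff ε)^[l] f 0‖ₑ + 2 ^ l * c := by
  have sum_choose_le : ∑ i ∈ Finset.range l, (l.choose (i + 1) : ℝ≥0∞) ≤ 2 ^ l := by
    have := (Finset.sum_range_succ' (fun i => l.choose i) l).symm.trans (Nat.sum_range_choose l)
    exact_mod_cast Nat.le_of_add_right_le this.le
  refine (enorm_le_enorm_fwdDiff_iter_add f ε l).trans ?_
  gcongr
  calc ∑ i ∈ Finset.range l, (l.choose (i + 1) : ℝ≥0∞) * ‖f ((i + 1 : ℕ) * ε)‖ₑ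
      ≤ ∑ i ∈ Finset.range l, (l.choose (i + 1) : ℝ≥0∞) * c := by
        gcongr with i
        exact hf i
    _ ≤ 2 ^ l * c := by
        rw [← Finset.sum_mul]
        gcongr

variable [NormedSpace ℝ F]

lemma enorm_sub_le_of_hasDerivAt {f f' : ℝ → F} {C : ℝ≥0∞} {a : ℝ}
    (hf : ∀ t, HasDerivAt f (f' t) t) (hC : ∀ t > a, ‖f' t‖ₑ ≤ C) {ε : ℝ} (hε : 0 < ε) :
    ‖f (a + ε) - f a‖ₑ ≤ ENNReal.ofReal ε * C := by
  rcases eq_or_ne C ⊤ with rfl | hCt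
  · simp [ENNReal.mul_top, hε]
  lift C to ℝ≥0 using hCt
  have lipschitzOnWith_Ioi : LipschitzOnWith C f (Ioi a) :=
    (convex_Ioi a).lipschitzOnWith_of_nnnorm_hasDerivWithin_le
      (fun t _ => (hf t).hasDerivWithinAt) fun t ht => enorm_le_coe.1 (hC t ht)
  have lipschitzOnWith_Ici : LipschitzOnWith C f (Ici a) := by
    rw [← closure_Ioi]
    exact lipschitzOnWith_Ioi.closure fun t _ => (hf t).continuousAt.continuousWithinAt
  have := lipschitzOnWith_Ici (show a + ε ∈ Ici a by simp [hε.le]) (show a ∈ Ici a by simp)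
  rwa [edist_eq_enorm_sub, edist_eq_enorm_sub, add_sub_cancel_left,
    Real.enorm_of_nonneg hε.le, mul_comm] at this

lemma enorm_fwdDiff_iter_le {g : ℕ → ℝ → F} (hg : ∀ l t, HasDerivAt (g l) (g (l + 1) t) t)
    {l : ℕ} {C : ℝ≥0∞} {a : ℝ} (hC : ∀ t > a, ‖g l t‖ₑ ≤ C) {ε : ℝ} (hε : 0 < ε) :
    ‖(fwdDiff ε)^[l] (g 0) a‖ₑ ≤ ENNReal.ofReal (ε ^ l) * C := by
  induction l generalizing g C with
  | zero =>
    have tendsto_right : Tendsto (fun t => ‖g 0 t‖ₑ) (𝓝[>] a) (𝓝 ‖g 0 a‖ₑ) :=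
      (hg 0 a).continuousAt.enorm.tendsto.mono_left nhdsWithin_le_nhds
    simpa using le_of_tendsto tendsto_right (eventually_mem_nhdsWithin.mono hC)
  | succ l ih =>
    have hasDerivAt_diff (i : ℕ) (t : ℝ) :
        HasDerivAt (fwdDiff ε (g i)) (fwdDiff ε (g (i + 1)) t) t :=
      ((hg i _).comp_add_const t ε).sub (hg i t)
    have diff_le (t : ℝ) (ht : a < t) : ‖fwdDiff ε (g l) t‖ₑ ≤ ENNReal.ofReal ε * C :=
      enorm_sub_le_of_hasDerivAt (hg l) (fun s hs => hC s (ht.trans hs)) hε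
    rw [Function.iterate_succ_apply, pow_succ, ENNReal.ofReal_mul (by positivity), mul_assoc]
    exact ih hasDerivAt_diff diff_le

end FiniteDifferences

section PointwiseEstimate

lemma hasDerivAt_integral_mul_of_hasCompactSupport {X : Type*} [TopologicalSpace X]
    [MeasurableSpace X] [OpensMeasurableSpace X] [T2Space X] {μ : Measure X}
    [IsFiniteMeasureOnCompacts μ] {φ : X → ℝ} (hφ : Continuous φ) (hφc : HasCompactSupport φ)
    {f f' : ℝ → X → ℝ} (hf : Continuous (Function.uncurry f))
    (hf' : Continuous (Function.uncurry f'))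
    (hff' : ∀ s y, HasDerivAt (fun s => f s y) (f' s y) s) (t : ℝ) :
    HasDerivAt (fun s => ∫ y, φ y * f s y ∂μ) (∫ y, φ y * f' t y ∂μ) t := by
  have integrable_mul {h : ℝ → X → ℝ} (hh : Continuous (Function.uncurry h)) (s : ℝ) :
      Integrable (fun y => φ y * h s y) μ :=
    (hφ.mul (hh.comp (.prodMk_right s))).integrable_of_hasCompactSupport hφc.mul_right
  obtain ⟨B, hB⟩ := ((isCompact_closedBall t 1).prod hφc.isCompact).exists_bound_of_continuousOn
    (f := fun z => φ z.2 * f' z.1 z.2) ((hφ.comp continuous_snd).mul hf').continuousOn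
  refine (hasDerivAt_integral_of_dominated_loc_of_deriv_le
    (F := fun s y => φ y * f s y) (F' := fun s y => φ y * f' s y) (s := closedBall t 1)
    (bound := (tsupport φ).indicator fun _ => B) (closedBall_mem_nhds t one_pos)
    (.of_forall fun s => (integrable_mul hf s).aestronglyMeasurable) (integrable_mul hf t)
    (integrable_mul hf' t).aestronglyMeasurable (ae_of_all _ fun y s hs => ?_)
    ((integrable_indicator_iff (isClosed_tsupport φ).measurableSet).2
      (integrableOn_const hφc.isCompact.measure_lt_top.ne))
    (ae_of_all _ fun y s _ => (hff' s y).const_mul (φ y))).2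
  by_cases hy : y ∈ tsupport φ
  · rw [indicator_of_mem hy]
    exact hB (s, y) ⟨hs, hy⟩
  · rw [indicator_of_notMem hy, image_eq_zero_of_notMem_tsupport hy, zero_mul, norm_zero]

variable {n j : ℕ} {φ w : Eucl n → ℝ}

/-- The vectors `(y, …, y, e_{a 0}, …, e_{a (j-1)})` with `l` copies of `y`, along which the
`(j + l)`-th derivative is evaluated. The recursion on `l` makes `j + (l + 1) = (j + l) + 1`
hold definitionally. -/
noncomputable def directions (a : Fin j → Fin n) (y : Eucl n) : (l : ℕ) → Fin (j + l) → Eucl n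
  | 0 => fun i => EuclideanSpace.single (a i) 1
  | l + 1 => (Fin.cons y (directions a y l) : Fin (j + l + 1) → Eucl n)

lemma prod_norm_directions (a : Fin j → Fin n) (y : Eucl n) (l : ℕ) :
    ∏ i, ‖directions a y l i‖ = ‖y‖ ^ l := by
  induction l with
  | zero => simp [directions]
  | succ l ih =>
    refine (Fin.prod_univ_succ (n := j + l) _).trans ?_
    simp [directions, ih, pow_succ']

lemma continuous_directions (a : Fin j → Fin n) (l : ℕ) :
    Continuous fun y => directions a y l := by
  induction l with
  | zero => exact continuous_const
  | succ l ih => exact Continuous.finCons continuous_id ih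

lemma continuous_iteratedFDeriv_directions (hw : ContDiff ℝ ∞ w) (a : Fin j → Fin n)
    (x : Eucl n) (l : ℕ) :
    Continuous fun z : ℝ × Eucl n =>
      iteratedFDeriv ℝ (j + l) w (x + z.1 • z.2) (directions a z.2 l) := by
  have := (hw.continuous_iteratedFDeriv (m := j + l) (by exact_mod_cast le_top))
  have := continuous_directions a l
  fun_prop

lemma hasDerivAt_iteratedFDeriv_directions (hw : ContDiff ℝ ∞ w) (a : Fin j → Fin n)
    (x y : Eucl n) (l : ℕ) (t : ℝ) :
    HasDerivAt (fun s : ℝ => iteratedFDeriv ℝ (j + l) w (x + s • y) (directions a y l))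
      (iteratedFDeriv ℝ (j + (l + 1)) w (x + t • y) (directions a y (l + 1))) t := by
  have hasDerivAt_line : HasDerivAt (fun s : ℝ => x + s • y) y t := by
    simpa using ((hasDerivAt_id t).smul_const y).const_add x
  have differentiableAt_apply : DifferentiableAt ℝ
      (fun z => iteratedFDeriv ℝ (j + l) w z (directions a y l)) (x + t • y) := by
    have := differentiable_iteratedFDeriv_of_contDiff hw (j + l) (x + t • y)
    fun_prop
  have hasDerivAt_comp := differentiableAt_apply.hasFDerivAt.comp_hasDerivAt t hasDerivAt_line
  rwa [← iteratedFDeriv_cons_apply hw] at hasDerivAt_comp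

/-- The `l`-th derivative in `s` of `∫ φ y * ∂_a w (x + s • y)`, the average of `∂_a w` over the
scale `s` around `x`. -/
noncomputable def directionalAverage (φ : Eucl n → ℝ) (a : Fin j → Fin n) (w : Eucl n → ℝ)
    (x : Eucl n) (l : ℕ) (s : ℝ) : ℝ :=
  ∫ y, φ y * iteratedFDeriv ℝ (j + l) w (x + s • y) (directions a y l)

lemma hasDerivAt_directionalAverage (hφ : Continuous φ) (hφc : HasCompactSupport φ)
    (hw : ContDiff ℝ ∞ w) (a : Fin j → Fin n) (x : Eucl n) (l : ℕ) (t : ℝ) :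
    HasDerivAt (directionalAverage φ a w x l) (directionalAverage φ a w x (l + 1) t) t :=
  hasDerivAt_integral_mul_of_hasCompactSupport hφ hφc
    (f := fun s y => iteratedFDeriv ℝ (j + l) w (x + s • y) (directions a y l))
    (f' := fun s y => iteratedFDeriv ℝ (j + (l + 1)) w (x + s • y) (directions a y (l + 1)))
    (continuous_iteratedFDeriv_directions hw a x l)
    (continuous_iteratedFDeriv_directions hw a x (l + 1))
    (fun s y => hasDerivAt_iteratedFDeriv_directions hw a x y l s) t

lemma directionalAverage_zero_eq (φ : Eucl n → ℝ) (a : Fin j → Fin n) (w : Eucl n → ℝ)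
    (x : Eucl n) (s : ℝ) :
    directionalAverage φ a w x 0 s = ∫ y, φ y * partialDeriv a w (x + s • y) := rfl

lemma directionalAverage_zero_zero (hφ1 : ∫ y, φ y = 1) (a : Fin j → Fin n) (w : Eucl n → ℝ)
    (x : Eucl n) : directionalAverage φ a w x 0 0 = partialDeriv a w x := by
  simp [directionalAverage_zero_eq, integral_mul_const, hφ1]

lemma exists_enorm_directionalAverage_le (hφ : Continuous φ) (hφc : HasCompactSupport φ)
    (a : Fin j → Fin n) (l : ℕ) :
    ∃ K : ℝ≥0, ∀ (w : Eucl n → ℝ) (x : Eucl n) (s : ℝ), 0 < s →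
      ‖directionalAverage φ a w x l s‖ₑ ≤
        K * maximalFunction volume (fun y => ‖classicalGradient (j + l) w y‖ₑ) x := by
  obtain ⟨K, hK⟩ := exists_lintegral_enorm_mul_comp_affine_le (μ := volume)
    (ψ := fun y => φ y * ‖y‖ ^ l) (by fun_prop) hφc.mul_right
  refine ⟨K, fun w x s hs => (enorm_integral_le_lintegral_enorm _).trans
    ((lintegral_mono fun y => ?_).trans (hK _ x s hs))⟩
  have apply_le := abs_iteratedFDeriv_apply_le w (x + s • y) (directions a y l)
  rw [prod_norm_directions, ← Real.norm_eq_abs, ← abs_of_nonneg (by positivity : 0 ≤ ‖y‖ ^ l),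
    ← Real.norm_eq_abs, ← norm_norm (classicalGradient _ _ _), ← norm_mul] at apply_le
  rw [enorm_mul, enorm_mul, mul_assoc, ← enorm_norm (classicalGradient _ _ _),
    ← enorm_mul (‖y‖ ^ l)]
  gcongr
  exact enorm_le_iff_norm_le.2 apply_le

lemma exists_enorm_directionalAverage_zero_le (hφ : ContDiff ℝ ∞ φ) (hφc : HasCompactSupport φ)
    (a : Fin j → Fin n) :
    ∃ K : ℝ≥0, ∀ w : Eucl n → ℝ, ContDiff ℝ ∞ w → ∀ (x : Eucl n) (s : ℝ), 0 < s →
      ‖directionalAverage φ a w x 0 s‖ₑ ≤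
        ENNReal.ofReal (s ^ j)⁻¹ * (K * maximalFunction volume (fun y => ‖w y‖ₑ) x) := by
  obtain ⟨K, hK⟩ := exists_lintegral_enorm_mul_comp_affine_le (μ := volume)
    (contDiff_partialDeriv hφ a).continuous (hasCompactSupport_partialDeriv hφc a)
  refine ⟨K, fun w hw x s hs => ?_⟩
  have by_parts : ∫ y, w (x + s • y) * partialDeriv a φ y =
      (-1) ^ j * (s ^ j * directionalAverage φ a w x 0 s) := by
    rw [integral_mul_partialDeriv (w := fun y => w (x + s • y)) (hw.comp (by fun_prop)) hφ hφc a,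
      directionalAverage_zero_eq]
    simp only [partialDeriv_comp_affine hw, mul_assoc, integral_const_mul, mul_comm (φ _)]
  have average_eq : directionalAverage φ a w x 0 s =
      (s ^ j)⁻¹ * ((-1) ^ j * ∫ y, w (x + s • y) * partialDeriv a φ y) := by
    rw [by_parts, ← mul_assoc ((-1) ^ j), ← mul_pow]
    field_simp
    simp
  rw [average_eq, enorm_mul, enorm_mul, Real.enorm_of_nonneg (by positivity), enorm_pow, enorm_neg,
    enorm_one, one_pow, one_mul]
  gcongr
  refine (enorm_integral_le_lintegral_enorm _).trans ?_
  simpa only [enorm_mul, mul_comm] using hK (fun z => ‖w z‖ₑ) x s hs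

lemma exists_enorm_partialDeriv_le (a : Fin j → Fin n) (l : ℕ) :
    ∃ C : ℝ≥0, ∀ w : Eucl n → ℝ, ContDiff ℝ ∞ w → ∀ (x : Eucl n) (ε : ℝ), 0 < ε →
      ‖partialDeriv a w x‖ₑ ≤
        C * (ENNReal.ofReal (ε ^ j)⁻¹ * maximalFunction volume (fun y => ‖w y‖ₑ) x +
          ENNReal.ofReal (ε ^ l) *
            maximalFunction volume (fun y => ‖classicalGradient (j + l) w y‖ₑ) x) := by
  let b : ContDiffBump (0 : Eucl n) := default
  obtain ⟨K₀, hK₀⟩ := exists_enorm_directionalAverage_zero_le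
    (b.contDiff_normed (μ := volume)) b.hasCompactSupport_normed a
  obtain ⟨K₁, hK₁⟩ := exists_enorm_directionalAverage_le
    (b.continuous_normed (μ := volume)) b.hasCompactSupport_normed a l
  refine ⟨2 ^ l * K₀ + K₁, fun w hw x ε hε => ?_⟩
  set M₀ := maximalFunction volume (fun y => ‖w y‖ₑ) x
  set M₁ := maximalFunction volume (fun y => ‖classicalGradient (j + l) w y‖ₑ) x
  have average_le (i : ℕ) : ‖directionalAverage (b.normed volume) a w x 0 ((i + 1 : ℕ) * ε)‖ₑ ≤
      ENNReal.ofReal (ε ^ j)⁻¹ * (K₀ * M₀) := by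
    refine (hK₀ w hw x _ (by positivity)).trans ?_
    gcongr
    exact le_mul_of_one_le_left hε.le (by simp)
  rw [← directionalAverage_zero_zero b.integral_normed a w x]
  calc ‖directionalAverage (b.normed volume) a w x 0 0‖ₑ
      ≤ ENNReal.ofReal (ε ^ l) * (K₁ * M₁) + 2 ^ l * (ENNReal.ofReal (ε ^ j)⁻¹ * (K₀ * M₀)) :=
        (enorm_le_enorm_fwdDiff_iter_add_two_pow_mul average_le l).trans <| add_le_add_left
          (enorm_fwdDiff_iter_le (hasDerivAt_directionalAverage b.continuous_normed
            b.hasCompactSupport_normed hw a x) (fun t ht => hK₁ w x t ht) hε) _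
    _ = K₁ * (ENNReal.ofReal (ε ^ l) * M₁) + (2 ^ l * K₀) * (ENNReal.ofReal (ε ^ j)⁻¹ * M₀) := by
        ring
    _ ≤ _ := by
        rw [add_comm, mul_add]
        push_cast
        gcongr
        · exact le_self_add
        · exact le_add_self

lemma enorm_euclideanSpace_le_sum {ι : Type*} [Fintype ι] (T : EuclideanSpace ℝ ι) :
    ‖T‖ₑ ≤ ∑ b, ‖T b‖ₑ := by
  classical
  calc ‖T‖ₑ = ‖∑ b, T b • EuclideanSpace.single b (1 : ℝ)‖ₑ := by
        simpa using congrArg enorm ((EuclideanSpace.basisFun ι ℝ).sum_repr T).symm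
    _ ≤ ∑ b, ‖T b • EuclideanSpace.single b (1 : ℝ)‖ₑ := enorm_sum_le _ _
    _ = ∑ b, ‖T b‖ₑ := by simp [enorm_eq_nnnorm, nnnorm_smul, -PiLp.smul_apply]

lemma exists_enorm_classicalGradient_le (n j l : ℕ) :
    ∃ C : ℝ≥0, ∀ w : Eucl n → ℝ, ContDiff ℝ ∞ w → ∀ (x : Eucl n) (ε : ℝ), 0 < ε →
      ‖classicalGradient j w x‖ₑ ≤
        C * (ENNReal.ofReal (ε ^ j)⁻¹ * maximalFunction volume (fun y => ‖w y‖ₑ) x +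
          ENNReal.ofReal (ε ^ l) *
            maximalFunction volume (fun y => ‖classicalGradient (j + l) w y‖ₑ) x) := by
  choose C hC using fun a : Fin j → Fin n => exists_enorm_partialDeriv_le a l
  refine ⟨∑ a, C a, fun w hw x ε hε => (enorm_euclideanSpace_le_sum _).trans ?_⟩
  push_cast
  rw [Finset.sum_mul]
  exact Finset.sum_le_sum fun a _ => hC a w hw x ε hε

end PointwiseEstimate

section Mollification

open ContinuousLinearMap
open scoped Convolution

lemma exists_seq_contDiffBump_tendsto_zero (E : Type*) [NormedAddCommGroup E] [NormedSpace ℝ E] :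
    ∃ b : ℕ → ContDiffBump (0 : E),
      Tendsto (fun i => (b i).rOut) atTop (𝓝 0) ∧ ∀ i, (b i).rOut ≤ 2 * (b i).rIn :=
  ⟨fun i =>
    { rIn := 1 / (i + 1 : ℝ) / 2
      rOut := 1 / (i + 1 : ℝ)
      rIn_pos := by positivity
      rIn_lt_rOut := half_lt_self (by positivity) },
    tendsto_one_div_add_atTop_nhds_zero_nat, fun i => (mul_div_cancel₀ _ two_ne_zero).ge⟩

lemma clm_convolution_apply {E F F' : Type*} [NormedAddCommGroup E] [NormedSpace ℝ E]
    [MeasurableSpace E] [BorelSpace E] {μ : Measure E}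
    [μ.IsAddLeftInvariant] [μ.IsNegInvariant] [NormedAddCommGroup F] [NormedSpace ℝ F]
    [CompleteSpace F] [NormedAddCommGroup F'] [NormedSpace ℝ F'] [CompleteSpace F']
    (T : F →L[ℝ] F') {η : E → ℝ} {g : E → F} (hη : Continuous η)
    (hc : HasCompactSupport η) (hg : LocallyIntegrable g μ) (x : E) :
    T ((η ⋆[lsmul ℝ ℝ, μ] g) x) = (η ⋆[lsmul ℝ ℝ, μ] fun y => T (g y)) x := by
  rw [convolution_def, ← T.integral_comp_comm (hc.convolutionExists_left _ hη hg x)]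
  simp [convolution_def]

variable {n m : ℕ} {η u : Eucl n → ℝ} {G : Eucl n → Tensor n m}

lemma contDiff_convolution (hη : ContDiff ℝ ∞ η) (hc : HasCompactSupport η)
    (hu : LocallyIntegrable u) : ContDiff ℝ ∞ (η ⋆[lsmul ℝ ℝ] u) :=
  hc.contDiff_convolution_left (n := (⊤ : ℕ∞)) (lsmul ℝ ℝ) hη hu

lemma fderiv_convolution_apply (hη : ContDiff ℝ ∞ η) (hc : HasCompactSupport η)
    (hu : LocallyIntegrable u) (x v : Eucl n) :
    fderiv ℝ (η ⋆[lsmul ℝ ℝ] u) x v = ((fun y => fderiv ℝ η y v) ⋆[lsmul ℝ ℝ] u) x := by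
  have contDiff_one : ContDiff ℝ 1 η := hη.of_le (by exact_mod_cast le_top)
  have convolutionExistsAt := (hc.fderiv ℝ).convolutionExists_left
    (precompL (Eucl n) (lsmul ℝ ℝ)) (contDiff_one.continuous_fderiv one_ne_zero) hu x
  rw [(hc.hasFDerivAt_convolution_left (lsmul ℝ ℝ) contDiff_one hu x).fderiv, convolution_def,
    integral_apply convolutionExistsAt]
  rfl

lemma partialDeriv_convolution (hη : ContDiff ℝ ∞ η) (hc : HasCompactSupport η)
    (hu : LocallyIntegrable u) (a : Fin m → Fin n) :
    partialDeriv a (η ⋆[lsmul ℝ ℝ] u) = partialDeriv a η ⋆[lsmul ℝ ℝ] u := by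
  induction m with
  | zero => simp only [partialDeriv_zero]
  | succ m ih =>
    rw [partialDeriv_succ (contDiff_convolution hη hc hu), ih, partialDeriv_succ hη]
    exact funext fun x => fderiv_convolution_apply (contDiff_partialDeriv hη _)
      (hasCompactSupport_partialDeriv hc _) hu x _

lemma IsWeakGradient.partialDeriv_convolution_apply (hG : IsWeakGradient m u G)
    (hu : LocallyIntegrable u) (hη : ContDiff ℝ ∞ η) (hc : HasCompactSupport η)
    (a : Fin m → Fin n) (x : Eucl n) :
    partialDeriv a (η ⋆[lsmul ℝ ℝ] u) x = (η ⋆[lsmul ℝ ℝ] fun y => G y a) x := by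
  have reflect_contDiff : ContDiff ℝ ∞ fun y => η (x + (-1 : ℝ) • y) := hη.comp (by fun_prop)
  have reflect_hasCompactSupport : HasCompactSupport fun y => η (x + (-1 : ℝ) • y) :=
    hc.comp_homeomorph
      ((Homeomorph.smulOfNeZero (-1 : ℝ) (by norm_num)).trans (Homeomorph.addLeft x))
  have integral_eq := hG.integral_eq _ reflect_contDiff reflect_hasCompactSupport a
  simp_rw [partialDeriv_comp_affine hη, mul_left_comm (u _), integral_const_mul] at integral_eq
  replace integral_eq := mul_left_cancel₀ (pow_ne_zero m (by norm_num)) integral_eq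
  rw [partialDeriv_convolution hη hc hu, convolution_eq_swap, convolution_eq_swap]
  simpa [mul_comm, sub_eq_add_neg] using integral_eq

lemma IsWeakGradient.classicalGradient_convolution (hG : IsWeakGradient m u G)
    (hu : LocallyIntegrable u) (hη : ContDiff ℝ ∞ η) (hc : HasCompactSupport η) :
    classicalGradient m (η ⋆[lsmul ℝ ℝ] u) = η ⋆[lsmul ℝ ℝ] G := by
  ext x a
  exact (hG.partialDeriv_convolution_apply hu hη hc a x).trans
    (clm_convolution_apply (EuclideanSpace.proj a) hη.continuous hc hG.locallyIntegrable x).symm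

lemma IsWeakGradient.ae_eq_zero (hG : IsWeakGradient m u G) (hu : u =ᵐ[volume] 0) :
    G =ᵐ[volume] 0 := by
  refine ae_eq_zero_of_integral_contDiff_smul_eq_zero hG.locallyIntegrable fun φ hφ hφc => ?_
  ext a
  have integral_eq := hG.integral_eq φ hφ hφc a
  rw [integral_eq_zero_of_ae (by filter_upwards [hu] with x hx; simp [hx])] at integral_eq
  replace integral_eq := (mul_eq_zero.1 integral_eq.symm).resolve_left
    (pow_ne_zero m (by norm_num))
  have integrable_smul : Integrable fun x => φ x • G x :=
    hG.locallyIntegrable.integrable_smul_left_of_hasCompactSupport hφ.continuous hφc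
  simpa [mul_comm] using
    ((EuclideanSpace.proj (𝕜 := ℝ) a).integral_comp_comm integrable_smul).symm.trans
      (by simpa [mul_comm] using integral_eq)

lemma exists_enorm_weakGradient_le (n j l : ℕ) :
    ∃ C : ℝ≥0, ∀ (u : Eucl n → ℝ) (Gj : Eucl n → Tensor n j) (Gk : Eucl n → Tensor n (j + l)),
      LocallyIntegrable u → IsWeakGradient j u Gj → IsWeakGradient (j + l) u Gk →
      ∀ᵐ x, ∀ ε : ℝ, 0 < ε → ‖Gj x‖ₑ ≤ C *
        (ENNReal.ofReal (ε ^ j)⁻¹ *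
            maximalFunction volume (maximalFunction volume fun y => ‖u y‖ₑ) x +
          ENNReal.ofReal (ε ^ l) *
            maximalFunction volume (maximalFunction volume fun y => ‖Gk y‖ₑ) x) := by
  obtain ⟨C, hC⟩ := exists_enorm_classicalGradient_le n j l
  obtain ⟨b, tendsto_rOut, rOut_le⟩ := exists_seq_contDiffBump_tendsto_zero (Eucl n)
  let K : ℝ≥0 := Real.toNNReal (2 ^ Module.finrank ℝ (Eucl n))
  refine ⟨C * K, fun u Gj Gk hu hGj hGk => ?_⟩
  let η (i : ℕ) := (b i).normed volume
  have contDiff_η (i : ℕ) : ContDiff ℝ ∞ (η i) := (b i).contDiff_normed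
  have hasCompactSupport_η (i : ℕ) : HasCompactSupport (η i) := (b i).hasCompactSupport_normed
  have maximal_convolution_le {F : Type} [NormedAddCommGroup F] [NormedSpace ℝ F]
      (g : Eucl n → F) (i : ℕ) (x : Eucl n) :
      maximalFunction volume (fun y => ‖(η i ⋆[lsmul ℝ ℝ] g) y‖ₑ) x ≤
        K * maximalFunction volume (maximalFunction volume fun y => ‖g y‖ₑ) x := by
    rw [← maximalFunction_const_mul ENNReal.coe_ne_top]
    exact maximalFunction_mono_ae
      (ae_of_all _ fun y => enorm_convolution_normed_le (b i) (rOut_le i) g y) x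
  filter_upwards [ContDiffBump.ae_convolution_tendsto_right_of_locallyIntegrable
    tendsto_rOut (.of_forall rOut_le) hGj.locallyIntegrable] with x hx ε hε
  refine le_of_tendsto hx.enorm (.of_forall fun i => ?_)
  have convolution_le := hC _ (contDiff_convolution (contDiff_η i) (hasCompactSupport_η i) hu)
    x ε hε
  rw [hGj.classicalGradient_convolution hu (contDiff_η i) (hasCompactSupport_η i),
    hGk.classicalGradient_convolution hu (contDiff_η i) (hasCompactSupport_η i)] at convolution_le
  refine convolution_le.trans ?_
  push_cast
  rw [mul_assoc, mul_add (K : ℝ≥0∞), mul_left_comm (K : ℝ≥0∞), mul_left_comm (K : ℝ≥0∞)]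
  gcongr <;> exact maximal_convolution_le _ i x

end Mollification

section ScaleOptimization

variable {s t : ℝ}

lemma exists_balancing_scale {a b : ℝ} (ha : 0 < a) (hb : 0 < b) (hst : s + t ≠ 0) :
    ∃ ε : ℝ, 0 < ε ∧ (ε ^ s)⁻¹ * b = a ^ (s / (s + t)) * b ^ (t / (s + t)) ∧
      ε ^ t * a = a ^ (s / (s + t)) * b ^ (t / (s + t)) := by
  obtain ⟨α, rfl⟩ : ∃ α, Real.exp α = a := ⟨Real.log a, Real.exp_log ha⟩
  obtain ⟨β, rfl⟩ : ∃ β, Real.exp β = b := ⟨Real.log b, Real.exp_log hb⟩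
  refine ⟨Real.exp ((β - α) / (s + t)), Real.exp_pos _, ?_, ?_⟩ <;>
  · simp only [← Real.exp_mul, ← Real.exp_neg, ← Real.exp_add]
    congr 1
    field_simp
    ring

lemma le_two_mul_rpow_of_forall_scale_of_pos {v C A B : ℝ≥0∞} (hA₀ : A ≠ 0) (hA : A ≠ ⊤)
    (hB₀ : B ≠ 0) (hB : B ≠ ⊤) (hst : s + t ≠ 0)
    (h : ∀ ε : ℝ, 0 < ε →
      v ≤ C * (ENNReal.ofReal (ε ^ s)⁻¹ * B + ENNReal.ofReal (ε ^ t) * A)) :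
    v ≤ 2 * C * (A ^ (s / (s + t)) * B ^ (t / (s + t))) := by
  obtain ⟨a, ha, rfl⟩ : ∃ a : ℝ, 0 < a ∧ ENNReal.ofReal a = A :=
    ⟨A.toReal, ENNReal.toReal_pos hA₀ hA, ENNReal.ofReal_toReal hA⟩
  obtain ⟨b, hb, rfl⟩ : ∃ b : ℝ, 0 < b ∧ ENNReal.ofReal b = B :=
    ⟨B.toReal, ENNReal.toReal_pos hB₀ hB, ENNReal.ofReal_toReal hB⟩
  obtain ⟨ε, hε, low_eq, high_eq⟩ := exists_balancing_scale ha hb hst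
  refine (h ε hε).trans (le_of_eq ?_)
  rw [← ENNReal.ofReal_mul (by positivity), ← ENNReal.ofReal_mul (by positivity), low_eq, high_eq,
    ENNReal.ofReal_rpow_of_pos ha, ENNReal.ofReal_rpow_of_pos hb,
    ← ENNReal.ofReal_mul (by positivity), ← two_mul, mul_comm (2 : ℝ≥0∞) C, mul_assoc]

lemma le_two_mul_rpow_of_forall_scale {v A B : ℝ≥0∞} {C : ℝ≥0} (hs : 0 < s) (ht : 0 < t)
    (hA : A ≠ ⊤) (hB : B ≠ ⊤)
    (h : ∀ ε : ℝ, 0 < ε →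
      v ≤ C * (ENNReal.ofReal (ε ^ s)⁻¹ * B + ENNReal.ofReal (ε ^ t) * A)) :
    v ≤ 2 * C * (A ^ (s / (s + t)) * B ^ (t / (s + t))) := by
  have le_perturbed (δ : ℝ≥0∞) (hδ : δ ∈ Ioo 0 1) :
      v ≤ 2 * C * ((A + δ) ^ (s / (s + t)) * (B + δ) ^ (t / (s + t))) := by
    have δ_ne_top : δ ≠ ⊤ := (hδ.2.trans ENNReal.one_lt_top).ne
    refine le_two_mul_rpow_of_forall_scale_of_pos (by simp [hδ.1.ne']) (by simp [hA, δ_ne_top])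
      (by simp [hδ.1.ne']) (by simp [hB, δ_ne_top]) (by positivity) fun ε hε =>
        (h ε hε).trans ?_
    gcongr <;> exact le_self_add
  have tendsto_perturbed (D : ℝ≥0∞) (θ : ℝ) :
      Tendsto (fun δ : ℝ≥0∞ => (D + δ) ^ θ) (𝓝[>] 0) (𝓝 (D ^ θ)) := by
    have : Continuous fun δ : ℝ≥0∞ => (D + δ) ^ θ := by fun_prop
    simpa using (this.tendsto 0).mono_left nhdsWithin_le_nhds
  have tendsto_rhs := ENNReal.Tendsto.const_mul (a := 2 * (C : ℝ≥0∞)) (ENNReal.Tendsto.mul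
    (tendsto_perturbed A (s / (s + t))) (.inr (by finiteness))
    (tendsto_perturbed B (t / (s + t))) (.inr (by finiteness))) (.inr (by finiteness))
  exact ge_of_tendsto tendsto_rhs (eventually_of_mem (Ioo_mem_nhdsGT one_pos) le_perturbed)

end ScaleOptimization

section LorentzInterpolation

lemma IsWeakGradient.lorentzNorm_eq_zero {n m : ℕ} {u : Eucl n → ℝ} {G : Eucl n → Tensor n m}
    (hG : IsWeakGradient m u G) {Q q : ℝ≥0∞} (hq : q ≠ 0) (hu : lorentzNorm u Q q = 0)
    (P p : ℝ≥0∞) : lorentzNorm G P p = 0 := by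
  rw [lorentzNorm_eq_lorentzFunctional] at hu ⊢
  have u_ae_eq_zero : u =ᵐ[volume] 0 := by
    filter_upwards [ae_eq_zero_of_lorentzFunctional_eq_zero hq hu] with x hx
    simpa using hx
  refine lorentzFunctional_eq_zero_of_ae_eq_zero ?_ P p
  filter_upwards [hG.ae_eq_zero u_ae_eq_zero] with x hx
  simp [hx]

lemma exists_lorentzNorm_weakGradient_le_of_ne_top (n : ℕ) {j l : ℕ} (hj : 1 ≤ j) (hl : 1 ≤ l)
    {P Q R p q r : ℝ≥0∞} (hP : P ≠ 0) (hQ : 1 < Q) (hR : 1 < R) (hp : p ≠ 0) (hq : 1 ≤ q)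
    (hr : 1 ≤ r)
    (hPQR : 1 / P = ENNReal.ofReal (j / (j + l)) / R + ENNReal.ofReal (l / (j + l)) / Q)
    (hpqr : 1 / p = ENNReal.ofReal (j / (j + l)) / r + ENNReal.ofReal (l / (j + l)) / q) :
    ∃ C : ℝ≥0, ∀ (u : Eucl n → ℝ) (Gj : Eucl n → Tensor n j) (Gk : Eucl n → Tensor n (j + l)),
      LocallyIntegrable u → IsWeakGradient j u Gj → IsWeakGradient (j + l) u Gk →
      lorentzNorm Gk R r ≠ ⊤ → lorentzNorm u Q q ≠ ⊤ →
      lorentzNorm Gj P p ≤ C *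
        (lorentzNorm Gk R r ^ ((j : ℝ) / (j + l)) * lorentzNorm u Q q ^ ((l : ℝ) / (j + l))) := by
  obtain ⟨C, pointwise_le⟩ := exists_enorm_weakGradient_le n j l
  obtain ⟨CR, maximal_le_R⟩ :=
    exists_lorentzFunctional_maximalFunction_maximalFunction_le (volume : Measure (Eucl n)) hR hr
  obtain ⟨CQ, maximal_le_Q⟩ :=
    exists_lorentzFunctional_maximalFunction_maximalFunction_le (volume : Measure (Eucl n)) hQ hq
  set θ : ℝ := j / (j + l)
  set η : ℝ := l / (j + l)
  have hθ : 0 < θ := by positivity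
  have hη : 0 < η := by positivity
  refine ⟨2 * C * (2⁻¹ ^ (-(1 / P).toReal) : ℝ).toNNReal * (CR ^ θ * CQ ^ η),
    fun u Gj Gk hu hGj hGk Gk_ne_top u_ne_top => ?_⟩
  simp only [lorentzNorm_eq_lorentzFunctional] at Gk_ne_top u_ne_top ⊢
  let A := maximalFunction volume (maximalFunction volume fun y => ‖Gk y‖ₑ)
  let B := maximalFunction volume (maximalFunction volume fun y => ‖u y‖ₑ)
  have lorentz_A_le := maximal_le_R _ hGk.locallyIntegrable.aestronglyMeasurable.enorm
  have lorentz_B_le := maximal_le_Q _ hu.aestronglyMeasurable.enorm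
  have enorm_Gj_le : ∀ᵐ x, ‖Gj x‖ₑ ≤ 2 * C * (A x ^ θ * B x ^ η) := by
    filter_upwards [pointwise_le u Gj Gk hu hGj hGk,
      ae_lt_top_of_lorentzFunctional_ne_top (zero_lt_one.trans_le hr).ne'
        (ne_top_of_le_ne_top (by finiteness) lorentz_A_le),
      ae_lt_top_of_lorentzFunctional_ne_top (zero_lt_one.trans_le hq).ne'
        (ne_top_of_le_ne_top (by finiteness) lorentz_B_le)] with x hx A_lt_top B_lt_top
    exact le_two_mul_rpow_of_forall_scale (by positivity) (by positivity) A_lt_top.ne B_lt_top.ne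
      (by simpa using hx)
  refine (lorentzFunctional_le_of_ae_le_mul_rpow hθ hη hP hp hPQR hpqr enorm_Gj_le).trans ?_
  refine (mul_le_mul_right (mul_le_mul' (ENNReal.rpow_le_rpow lorentz_A_le hθ.le)
    (ENNReal.rpow_le_rpow lorentz_B_le hη.le)) _).trans (le_of_eq ?_)
  rw [ENNReal.mul_rpow_of_nonneg _ _ hθ.le, ENNReal.mul_rpow_of_nonneg _ _ hη.le]
  push_cast [ENNReal.coe_rpow_of_nonneg _ hθ.le, ENNReal.coe_rpow_of_nonneg _ hη.le]
  rw [ENNReal.ofReal]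
  ring

lemma rpow_mul_rpow_eq_top {a b : ℝ≥0∞} {θ η : ℝ} (hθ : 0 < θ) (hη : 0 < η) (hb : b ≠ 0)
    (hab : ¬(a = 0 ∧ b = ⊤)) (h : a = ⊤ ∨ b = ⊤) : a ^ θ * b ^ η = ⊤ := by
  rcases h with rfl | rfl
  · rw [ENNReal.top_rpow_of_pos hθ, ENNReal.top_mul]
    simp [hb, hη.not_gt]
  · have ha : a ≠ 0 := fun ha => hab ⟨ha, rfl⟩
    rw [ENNReal.top_rpow_of_pos hη, ENNReal.mul_top]
    simp [ha, hθ.not_gt]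

lemma natCast_div_add_eq_ofReal {j l : ℕ} (hl : 1 ≤ l) :
    (j : ℝ≥0∞) / (j + l : ℕ) = ENNReal.ofReal (j / (j + l)) := by
  rw [ENNReal.ofReal_div_of_pos (by positivity)]
  simp [ENNReal.ofReal_add]

lemma one_sub_div_add_eq {j l : ℕ} (hl : 1 ≤ l) : 1 - (j : ℝ) / (j + l) = l / (j + l) := by
  field_simp
  ring

end LorentzInterpolation

end GagliardoNirenberg

/-- The last hypothesis only excludes that the right-hand side is the indeterminate product `0 · ∞`
(for instance, for non-zero polynomials of degree less than `k`). -/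
theorem corollary1p3 (n j k : ℕ) (hj : 1 ≤ j) (hjk : j < k)
    (P Q R p q r : ℝ≥0∞) (hP : 1 < P) (hQ : 1 < Q) (hR : 1 < R)
    (hp : 1 ≤ p) (hq : 1 ≤ q) (hr : 1 ≤ r)
    (hPQR : 1 / P = ((j : ℝ≥0∞) / k) / R + (1 - (j : ℝ≥0∞) / k) / Q)
    (hpqr : 1 / p = ((j : ℝ≥0∞) / k) / r + (1 - (j : ℝ≥0∞) / k) / q) :
    ∃ C : ℝ≥0, ∀ u : Eucl n → ℝ, WeaklyDifferentiable k u →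
      ∀ (Gj : Eucl n → Tensor n j) (Gk : Eucl n → Tensor n k),
        IsWeakGradient j u Gj → IsWeakGradient k u Gk →
        ¬ (lorentzNorm Gk R r = 0 ∧ lorentzNorm u Q q = ⊤) →
        lorentzNorm Gj P p ≤
          C * lorentzNorm Gk R r ^ ((j : ℝ) / k) * lorentzNorm u Q q ^ (1 - (j : ℝ) / k) := by
  obtain ⟨l, rfl⟩ := Nat.exists_eq_add_of_le hjk.le
  have hl : 1 ≤ l := by omega
  have one_sub_eq : 1 - ENNReal.ofReal (j / (j + l)) = ENNReal.ofReal (l / (j + l)) := by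
    rw [← one_sub_div_add_eq hl, ENNReal.ofReal_sub _ (by positivity), ENNReal.ofReal_one]
  rw [natCast_div_add_eq_ofReal hl, one_sub_eq] at hPQR hpqr
  obtain ⟨C, hC⟩ := exists_lorentzNorm_weakGradient_le_of_ne_top n hj hl
    (zero_lt_one.trans hP).ne' hQ hR (zero_lt_one.trans_le hp).ne' hq hr hPQR hpqr
  refine ⟨C + 1, fun u hu Gj Gk hGj hGk not_indeterminate => ?_⟩
  rw [Nat.cast_add, one_sub_div_add_eq hl, mul_assoc]
  by_cases u_eq_zero : lorentzNorm u Q q = 0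
  · rw [hGj.lorentzNorm_eq_zero (zero_lt_one.trans_le hq).ne' u_eq_zero]
    exact zero_le
  by_cases infinite : lorentzNorm Gk R r = ⊤ ∨ lorentzNorm u Q q = ⊤
  · rw [rpow_mul_rpow_eq_top (by positivity) (by positivity) u_eq_zero not_indeterminate infinite,
      ENNReal.mul_top (by simp)]
    exact le_top
  · rw [not_or] at infinite
    refine (hC u Gj Gk hu.locallyIntegrable hGj hGk infinite.1 infinite.2).trans ?_
    gcongr
    simp
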